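/- Let $\mathbf{Man}$ be the category of smooth finite-dimensional manifolds and smooth maps. For $q\ge 0$ let $\Omega^q\colon \mathbf{Man}^{\mathrm{op}}\to\mathbf{Set}$ be the presheaf sending a manifold $M$ to the set $\Omega^q(M)$ of smooth real differential $q$-forms on $M$, with pullback of forms as restriction. For a presheaf $\mathcal F\colon\mathbf{Man}^{\mathrm{op}}\to\mathbf{Set}$ let $\Omega^q(\mathcal F)$ be the real vector space of natural transformations (of set-valued functors) $\mathcal F\to\Omega^q$, with the vector space structure, wedge product and exterior derivative $d\colon\Omega^q(\mathcal F)\to\Omega^{q+1}(\mathcal F)$ induced by those of $\Omega^\bullet(M)$, $M\in\mathbf{Man}$. The complex $\Omega^0(\mathcal F)\xrightarrow{d}\Omega^1(\mathcal F)\xrightarrow{d}\Omega^2(\mathcal F)\to\cdots$ is the de Rham complex of $\mathcal F$, and its cohomology is the de Rham cohomology $H^\bullet_{dR}(\mathcal F)$. Let $\omega=\mathrm{id}_{\Omega^1}\in\Omega^1(\Omega^1)$ be the tautological $1$-form. **Theorem.** For every $q\ge 0$ the vector space $\Omega^q(\Omega^1)$ is one-dimensional; it is spanned by $(d\omega)^{\wedge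 q/2}$ if $q$ is even and by $\omega\wedge(d\omega)^{\wedge (q-1)/2}$ if $q$ is odd. The de Rham complex of $\Omega^1$ is isomorphic, as a cochain complex of real vector spaces, to $$\mathbb R\xrightarrow{\ 0\ }\mathbb R\xrightarrow{\ 1\ }\mathbb R\xrightarrow{\ 0\ }\mathbb R\xrightarrow{\ 1\ }\cdots,$$ by an isomorphism sending each of the generators above to $1\in\mathbb R$. In particular $H^0_{dR}(\Omega^1)\cong\mathbb R$ and $H^q_{dR}(\Omega^1)=0$ for $q\neq 0$. -/

import Mathlib

open scoped Manifold ContDiff Topology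
open CategoryTheory Opposite

/-- The smooth finite dimensional manifolds: Hausdorff second countable spaces with a smooth
atlas modelled on `ℝ^dim` (no boundary). The empty manifold is allowed. -/
structure Man where
  carrier : Type
  dim : ℕ
  [topology : TopologicalSpace carrier]
  [charted : ChartedSpace (EuclideanSpace ℝ (Fin dim)) carrier]
  [smooth : IsManifold (𝓡 dim) ∞ carrier]
  [hausdorff : T2Space carrier]
  [secondCountable : SecondCountableTopology carrier]

noncomputable section

namespace Man

instance : CoeSort Man Type := ⟨Man.carrier⟩

attribute [instance] topology charted smooth hausdorff secondCountable

/-- The model space `ℝ^dim` of `M`. -/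
abbrev Model (M : Man) : Type := EuclideanSpace ℝ (Fin M.dim)

/-- The category of manifolds and smooth maps. -/
instance : Category Man where
  Hom M N := C^∞⟮𝓡 M.dim, M; 𝓡 N.dim, N⟯
  id M := ContMDiffMap.id
  comp f g := ContMDiffMap.comp g f

end Man

section LinearAlgebra

variable {E F : Type*} [NormedAddCommGroup E] [NormedSpace ℝ E]
  [NormedAddCommGroup F] [NormedSpace ℝ F] {p q : ℕ}

/-- The tensor product `α ⊗ β` of two alternating forms, as a multilinear form. -/
def tensorForm (α : E [⋀^Fin p]→L[ℝ] ℝ) (β : E [⋀^Fin q]→L[ℝ] ℝ) :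
    ContinuousMultilinearMap ℝ (fun _ : Fin (p + q) => E) ℝ where
  toMultilinearMap := ((LinearMap.mul' ℝ ℝ).compMultilinearMap
    (α.toMultilinearMap.domCoprod β.toMultilinearMap)).domDomCongr finSumFinEquiv
  cont := by
    change Continuous fun v : Fin (p + q) → E =>
      α (fun i => v (Fin.castAdd q i)) * β (fun i => v (Fin.natAdd p i))
    have h1 := α.cont
    have h2 := β.cont
    exact (h1.comp (by fun_prop)).mul (h2.comp (by fun_prop))

theorem tensorForm_apply (α : E [⋀^Fin p]→L[ℝ] ℝ) (β : E [⋀^Fin q]→L[ℝ] ℝ)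
    (v : Fin (p + q) → E) :
    tensorForm α β v = α (fun i => v (Fin.castAdd q i)) * β (fun i => v (Fin.natAdd p i)) :=
  rfl

/-- The exterior product of alternating forms, with the determinant normalization
`(dx ∧ dy)(v, w) = dx v * dy w - dx w * dy v`; see `wedgeAt_apply` for the formula. -/
def wedgeAt (α : E [⋀^Fin p]→L[ℝ] ℝ) (β : E [⋀^Fin q]→L[ℝ] ℝ) : E [⋀^Fin (p + q)]→L[ℝ] ℝ :=
  ((p.factorial : ℝ) * (q.factorial : ℝ))⁻¹ •
    ContinuousMultilinearMap.alternatization (tensorForm α β)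

theorem wedgeAt_apply (α : E [⋀^Fin p]→L[ℝ] ℝ) (β : E [⋀^Fin q]→L[ℝ] ℝ)
    (v : Fin (p + q) → E) :
    wedgeAt α β v = ((p.factorial : ℝ) * (q.factorial : ℝ))⁻¹ *
      ∑ σ : Equiv.Perm (Fin (p + q)), ((Equiv.Perm.sign σ : ℤ) : ℝ) *
        (α (fun i => v (σ (Fin.castAdd q i))) * β (fun i => v (σ (Fin.natAdd p i)))) := by
  rw [wedgeAt, ContinuousAlternatingMap.smul_apply,
    ContinuousMultilinearMap.alternatization_apply_apply, smul_eq_mul]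
  congr 1
  refine Finset.sum_congr rfl fun σ _ => ?_
  rw [tensorForm_apply, Units.smul_def, zsmul_eq_mul]
  rfl

theorem wedgeAt_comp (α : F [⋀^Fin p]→L[ℝ] ℝ) (β : F [⋀^Fin q]→L[ℝ] ℝ) (A : E →L[ℝ] F) :
    (wedgeAt α β).compContinuousLinearMap A =
      wedgeAt (α.compContinuousLinearMap A) (β.compContinuousLinearMap A) := by
  ext v
  simp only [ContinuousAlternatingMap.compContinuousLinearMap_apply, wedgeAt_apply]
  rfl

/-- The exterior product as a bilinear map. -/
def wedgeBilin : (E [⋀^Fin p]→L[ℝ] ℝ) →ₗ[ℝ] (E [⋀^Fin q]→L[ℝ] ℝ) →ₗ[ℝ]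
    (E [⋀^Fin (p + q)]→L[ℝ] ℝ) :=
  LinearMap.mk₂ ℝ wedgeAt
    (fun a b c => by
      ext v
      simp only [wedgeAt_apply, ContinuousAlternatingMap.add_apply, add_mul, mul_add,
        Finset.sum_add_distrib])
    (fun r a c => by
      ext v
      simp only [wedgeAt_apply, ContinuousAlternatingMap.smul_apply, smul_eq_mul, Finset.mul_sum]
      exact Finset.sum_congr rfl fun _ _ => by ring)
    (fun a b c => by
      ext v
      simp only [wedgeAt_apply, ContinuousAlternatingMap.add_apply, mul_add,
        Finset.sum_add_distrib])
    (fun r a c => by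
      ext v
      simp only [wedgeAt_apply, ContinuousAlternatingMap.smul_apply, smul_eq_mul, Finset.mul_sum]
      exact Finset.sum_congr rfl fun _ _ => by ring)

instance finiteDimensional_continuousMultilinear [FiniteDimensional ℝ E] :
    FiniteDimensional ℝ (ContinuousMultilinearMap ℝ (fun _ : Fin q => E) ℝ) :=
  FiniteDimensional.of_injective
    (ContinuousMultilinearMap.toMultilinearMapLinear (R' := ℝ) (A := ℝ))
    ContinuousMultilinearMap.toMultilinearMap_injective

instance finiteDimensional_continuousAlternating [FiniteDimensional ℝ E] :
    FiniteDimensional ℝ (E [⋀^Fin q]→L[ℝ] ℝ) :=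
  FiniteDimensional.of_injective
    (ContinuousAlternatingMap.toContinuousMultilinearMapLinear (R := ℝ) (A := ℝ))
    ContinuousAlternatingMap.toContinuousMultilinearMap_injective

theorem contDiffOn_comp [FiniteDimensional ℝ E] {G : Type*} [NormedAddCommGroup G]
    [NormedSpace ℝ G] {s : Set G} {a : G → F [⋀^Fin q]→L[ℝ] ℝ} {A : G → E →L[ℝ] F}
    (ha : ContDiffOn ℝ ∞ a s) (hA : ContDiffOn ℝ ∞ A s) :
    ContDiffOn ℝ ∞ (fun y => (a y).compContinuousLinearMap (A y)) s := by
  let L : (E [⋀^Fin q]→L[ℝ] ℝ) →ₗ[ℝ] ContinuousMultilinearMap ℝ (fun _ : Fin q => E) ℝ :=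
    ContinuousAlternatingMap.toContinuousMultilinearMapLinear (R := ℝ) (A := ℝ)
  obtain ⟨R, hR⟩ := L.exists_leftInverse_of_injective (LinearMap.ker_eq_bot.2
    ContinuousAlternatingMap.toContinuousMultilinearMap_injective)
  have h1 : ContDiffOn ℝ ∞ (fun y =>
      ContinuousMultilinearMap.compContinuousLinearMapContinuousMultilinear ℝ
        (fun _ : Fin q => E) (fun _ : Fin q => F) ℝ (fun _ => A y)
        (ContinuousAlternatingMap.toContinuousMultilinearMapCLM ℝ (a y))) s := by
    refine ContDiffOn.clm_apply ?_ ?_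
    · exact (ContinuousMultilinearMap.contDiff _).comp_contDiffOn (contDiffOn_pi.2 fun _ => hA)
    · exact (ContinuousLinearMap.contDiff _).comp_contDiffOn ha
  have h2 := (LinearMap.toContinuousLinearMap R).contDiff.comp_contDiffOn h1
  refine h2.congr fun y _ => ?_
  have := LinearMap.congr_fun hR ((a y).compContinuousLinearMap (A y))
  exact this.symm

end LinearAlgebra

/-- The pullback along `h : E → M` of a (not necessarily smooth) field of alternating `q`-forms
on the tangent spaces of `M`. -/
def plotPullback {E : Type*} [NormedAddCommGroup E] [NormedSpace ℝ E] {q : ℕ} {M : Man}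
    (η : ∀ x : M, TangentSpace (𝓡 M.dim) x [⋀^Fin q]→L[ℝ] ℝ) (h : E → M) (y : E) :
    E [⋀^Fin q]→L[ℝ] ℝ :=
  (η (h y)).compContinuousLinearMap (mfderiv 𝓘(ℝ, E) (𝓡 M.dim) h y)

/-- The expression of a field of alternating `q`-forms on `M` in the preferred chart at `x₀`, a
`q`-form on the model space (meaningful on the target of the chart). -/
def localRep {q : ℕ} {M : Man} (η : ∀ x : M, TangentSpace (𝓡 M.dim) x [⋀^Fin q]→L[ℝ] ℝ)
    (x₀ : M) : M.Model → M.Model [⋀^Fin q]→L[ℝ] ℝ :=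
  plotPullback η (extChartAt (𝓡 M.dim) x₀).symm

section plots
variable {E E' : Type*} [NormedAddCommGroup E] [NormedSpace ℝ E]
  [NormedAddCommGroup E'] [NormedSpace ℝ E'] {q : ℕ} {M : Man}
    (η : ∀ x : M, TangentSpace (𝓡 M.dim) x [⋀^Fin q]→L[ℝ] ℝ)

theorem plotPullback_congr {h h' : E → M} {y : E} (hh : h =ᶠ[𝓝 y] h') :
    plotPullback η h y = plotPullback η h' y := by
  have key : ∀ (x x' : M) (_ : x = x') (A : E →L[ℝ] M.Model),
      (η x).compContinuousLinearMap (show E →L[ℝ] TangentSpace (𝓡 M.dim) x from A) =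
        (η x').compContinuousLinearMap (show E →L[ℝ] TangentSpace (𝓡 M.dim) x' from A) := by
    rintro x _ rfl A
    rfl
  unfold plotPullback
  rw [hh.mfderiv_eq]
  exact key _ _ hh.self_of_nhds _

theorem plotPullback_comp {g : E → E'} {h : E' → M} {y : E} (hg : DifferentiableAt ℝ g y)
    (hh : MDifferentiableAt 𝓘(ℝ, E') (𝓡 M.dim) h (g y)) :
    plotPullback η (h ∘ g) y =
      (plotPullback η h (g y)).compContinuousLinearMap (fderiv ℝ g y) := by
  unfold plotPullback
  rw [mfderiv_comp y hh hg.mdifferentiableAt, mfderiv_eq_fderiv]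
  rfl

theorem plotPullback_eventuallyEq {h : E → M} {U : Set E} (hU : IsOpen U)
    (hh : ContMDiffOn 𝓘(ℝ, E) (𝓡 M.dim) ∞ h U) {y : E} (hy : y ∈ U) (x₀ : M)
    (hx : h y ∈ (extChartAt (𝓡 M.dim) x₀).source) :
    ∃ V : Set E, IsOpen V ∧ y ∈ V ∧ V ⊆ U ∧ Set.MapsTo h V (extChartAt (𝓡 M.dim) x₀).source ∧
      ContDiffOn ℝ ∞ (extChartAt (𝓡 M.dim) x₀ ∘ h) V ∧
      ∀ z ∈ V, plotPullback η h z = (localRep η x₀ (extChartAt (𝓡 M.dim) x₀ (h z))).compContinuousLinearMap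
        (fderiv ℝ (extChartAt (𝓡 M.dim) x₀ ∘ h) z) := by
  have hV : IsOpen (U ∩ h ⁻¹' (extChartAt (𝓡 M.dim) x₀).source) :=
    hh.continuousOn.isOpen_inter_preimage hU (isOpen_extChartAt_source x₀)
  have hs : ContDiffOn ℝ ∞ (extChartAt (𝓡 M.dim) x₀ ∘ h)
      (U ∩ h ⁻¹' (extChartAt (𝓡 M.dim) x₀).source) := by
    rw [← contMDiffOn_iff_contDiffOn]
    have h1 := contMDiffOn_extChartAt (I := 𝓡 M.dim) (n := ∞) (x := x₀)
    refine h1.comp (hh.mono Set.inter_subset_left) fun z hz => ?_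
    simpa using hz.2
  refine ⟨_, hV, ⟨hy, hx⟩, Set.inter_subset_left, fun z hz => hz.2, hs, fun z hz => ?_⟩
  have hd : DifferentiableAt ℝ (extChartAt (𝓡 M.dim) x₀ ∘ h) z :=
    (hs.contDiffAt (hV.mem_nhds hz)).differentiableAt (by simp)
  have hm : MDifferentiableAt 𝓘(ℝ, M.Model) (𝓡 M.dim) (extChartAt (𝓡 M.dim) x₀).symm
      ((extChartAt (𝓡 M.dim) x₀ ∘ h) z) := by
    have := contMDiffOn_extChartAt_symm (I := 𝓡 M.dim) (n := ∞) x₀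
    refine (this.contMDiffAt ?_).mdifferentiableAt (by simp)
    exact (isOpen_extChartAt_target x₀).mem_nhds ((extChartAt (𝓡 M.dim) x₀).map_source hz.2)
  rw [localRep, ← Function.comp_apply (f := extChartAt (𝓡 M.dim) x₀) (g := h), ← plotPullback_comp η hd hm]
  refine plotPullback_congr η ?_
  filter_upwards [hV.mem_nhds hz] with w hw
  exact ((extChartAt (𝓡 M.dim) x₀).left_inv hw.2).symm

theorem contDiffOn_plotPullback [FiniteDimensional ℝ E]
    (hη : ∀ x₀ : M, ContDiffOn ℝ ∞ (localRep η x₀) (extChartAt (𝓡 M.dim) x₀).target)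
    {h : E → M} {U : Set E} (hU : IsOpen U)
    (hh : ContMDiffOn 𝓘(ℝ, E) (𝓡 M.dim) ∞ h U) :
    ContDiffOn ℝ ∞ (plotPullback η h) U := by
  intro y hy
  obtain ⟨V, hV, hyV, -, hmaps, hs, heq⟩ :=
    plotPullback_eventuallyEq η hU hh hy (h y) (mem_extChartAt_source _)
  have h1 : ContDiffOn ℝ ∞ (fun z => (localRep η (h y)
      (extChartAt (𝓡 M.dim) (h y) (h z))).compContinuousLinearMap
        (fderiv ℝ (extChartAt (𝓡 M.dim) (h y) ∘ h) z)) V := by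
    refine contDiffOn_comp ?_ (hs.fderiv_of_isOpen hV (by simp))
    exact (hη (h y)).comp hs fun z hz => (extChartAt (𝓡 M.dim) (h y)).map_source (hmaps hz)
  exact ((h1.congr heq).contDiffAt (hV.mem_nhds hyV)).contDiffWithinAt

end plots

/-- Smooth differential `q`-forms on `M`: fields of alternating `q`-forms on the tangent spaces
whose expressions in the charts are smooth. -/
@[ext]
structure Form (q : ℕ) (M : Man) where
  toFun : ∀ x : M, TangentSpace (𝓡 M.dim) x [⋀^Fin q]→L[ℝ] ℝ
  smooth : ∀ x₀ : M, ContDiffOn ℝ ∞ (localRep toFun x₀) (extChartAt (𝓡 M.dim) x₀).target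

namespace Form

variable {p q : ℕ} {M N P : Man}

instance : Zero (Form q M) := ⟨⟨fun _ => 0, fun _ => contDiffOn_const (c := 0)⟩⟩

instance : Add (Form q M) :=
  ⟨fun η θ => ⟨fun x => η.toFun x + θ.toFun x, fun x₀ => (η.smooth x₀).add (θ.smooth x₀)⟩⟩

instance : Neg (Form q M) := ⟨fun η => ⟨fun x => -η.toFun x, fun x₀ => (η.smooth x₀).neg⟩⟩

instance : SMul ℝ (Form q M) :=
  ⟨fun c η => ⟨fun x => c • η.toFun x, fun x₀ => (η.smooth x₀).const_smul c⟩⟩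

instance : AddCommGroup (Form q M) where
  add_assoc _ _ _ := Form.ext (funext fun _ => add_assoc _ _ _)
  zero_add _ := Form.ext (funext fun _ => zero_add _)
  add_zero _ := Form.ext (funext fun _ => add_zero _)
  add_comm _ _ := Form.ext (funext fun _ => add_comm _ _)
  neg_add_cancel _ := Form.ext (funext fun _ => neg_add_cancel _)
  nsmul := nsmulRec
  zsmul := zsmulRec

instance : Module ℝ (Form q M) where
  one_smul _ := Form.ext (funext fun _ => one_smul _ _)
  mul_smul _ _ _ := Form.ext (funext fun _ => mul_smul _ _ _)
  smul_zero _ := Form.ext (funext fun _ => smul_zero _)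
  smul_add _ _ _ := Form.ext (funext fun _ => smul_add _ _ _)
  add_smul _ _ _ := Form.ext (funext fun _ => add_smul _ _ _)
  zero_smul _ := Form.ext (funext fun _ => zero_smul _ _)

theorem add_toFun (η θ : Form q M) (x : M) : (η + θ).toFun x = η.toFun x + θ.toFun x := rfl

theorem smul_toFun (c : ℝ) (η : Form q M) (x : M) : (c • η).toFun x = c • η.toFun x := rfl

theorem zero_toFun (x : M) : (0 : Form q M).toFun x = 0 := rfl

theorem differentiableAt_localRep (η : Form q M) (x : M) :
    DifferentiableAt ℝ (localRep η.toFun x) (extChartAt (𝓡 M.dim) x x) :=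
  ((η.smooth x).contDiffAt ((isOpen_extChartAt_target x).mem_nhds
    (mem_extChartAt_target x))).differentiableAt (by simp)

theorem minSmoothness_two_le : minSmoothness ℝ 2 ≤ (∞ : WithTop ℕ∞) := by
  rw [minSmoothness_of_isRCLikeNormedField]
  exact WithTop.coe_le_coe.2 le_top

/-- The pullback `f^* η` of a differential form along a smooth map. -/
def pullback (f : M ⟶ N) (η : Form q N) : Form q M :=
  ⟨fun x => (η.toFun (f.1 x)).compContinuousLinearMap (mfderiv (𝓡 M.dim) (𝓡 N.dim) f.1 x), fun x₀ => by
    have ho := isOpen_extChartAt_target (I := 𝓡 M.dim) x₀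
    have hs := contMDiffOn_extChartAt_symm (I := 𝓡 M.dim) (n := ∞) x₀
    refine (contDiffOn_plotPullback η.toFun η.smooth ho (f.2.comp_contMDiffOn hs)).congr fun y hy => ?_
    unfold localRep plotPullback
    rw [mfderiv_comp y (f.2.mdifferentiable (by simp) _)
      ((hs.contMDiffAt (ho.mem_nhds hy)).mdifferentiableAt (by simp))]
    rfl⟩

theorem plotPullback_pullback {E : Type*} [NormedAddCommGroup E] [NormedSpace ℝ E]
    (f : M ⟶ N) (η : Form q N) {h : E → M} {y : E}
    (hh : MDifferentiableAt 𝓘(ℝ, E) (𝓡 M.dim) h y) :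
    plotPullback (pullback f η).toFun h y = plotPullback η.toFun (f.1 ∘ h) y := by
  unfold plotPullback
  rw [mfderiv_comp y (f.2.mdifferentiable (by simp) _) hh]
  rfl

/-- The exterior derivative of `η` at `x`, computed in the preferred chart at `x`. It agrees with
the one computed in any other preferred chart (`localRep_extDerivAt`). -/
def extDerivAt (η : Form q M) (x : M) : TangentSpace (𝓡 M.dim) x [⋀^Fin (q + 1)]→L[ℝ] ℝ :=
  (_root_.extDeriv (localRep η.toFun x) (extChartAt (𝓡 M.dim) x x)).compContinuousLinearMap
    (mfderiv (𝓡 M.dim) 𝓘(ℝ, M.Model) (extChartAt (𝓡 M.dim) x) x)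

theorem extDeriv_plotPullback {E : Type*} [NormedAddCommGroup E] [NormedSpace ℝ E]
    (η : Form q M) {h : E → M} {U : Set E} (hU : IsOpen U)
    (hh : ContMDiffOn 𝓘(ℝ, E) (𝓡 M.dim) ∞ h U) {y : E} (hy : y ∈ U) :
    _root_.extDeriv (plotPullback η.toFun h) y = plotPullback (extDerivAt η) h y := by
  obtain ⟨V, hV, hyV, -, hmaps, hs, heq⟩ :=
    plotPullback_eventuallyEq η.toFun hU hh hy (h y) (mem_extChartAt_source _)
  have he := Filter.EventuallyEq.extDeriv_eq (Filter.eventuallyEq_of_mem (hV.mem_nhds hyV) heq)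
  rw [he]
  have hη : DifferentiableAt ℝ (localRep η.toFun (h y)) ((extChartAt (𝓡 M.dim) (h y) ∘ h) y) :=
    η.differentiableAt_localRep (h y)
  have hg : ContDiffAt ℝ ∞ (extChartAt (𝓡 M.dim) (h y) ∘ h) y := hs.contDiffAt (hV.mem_nhds hyV)
  have := extDeriv_pullback hη hg minSmoothness_two_le
  refine this.trans ?_
  unfold plotPullback extDerivAt
  rw [← mfderiv_eq_fderiv, mfderiv_comp y (mdifferentiableAt_extChartAt (mem_chart_source _ _))
    ((hh.contMDiffAt (hU.mem_nhds hy)).mdifferentiableAt (by simp))]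
  rfl

theorem localRep_extDerivAt (η : Form q M) (x₀ : M) {y : M.Model}
    (hy : y ∈ (extChartAt (𝓡 M.dim) x₀).target) :
    localRep (extDerivAt η) x₀ y = _root_.extDeriv (localRep η.toFun x₀) y :=
  (extDeriv_plotPullback η (isOpen_extChartAt_target x₀)
    (contMDiffOn_extChartAt_symm (I := 𝓡 M.dim) (n := ∞) x₀) hy).symm

/-- The exterior derivative `d : Ω^q(M) → Ω^(q+1)(M)`. -/
def d (η : Form q M) : Form (q + 1) M :=
  ⟨extDerivAt η, fun x₀ => by
    have h1 : ContDiffOn ℝ ∞ (_root_.extDeriv (localRep η.toFun x₀))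
        (extChartAt (𝓡 M.dim) x₀).target :=
      (ContinuousAlternatingMap.alternatizeUncurryFinCLM ℝ M.Model ℝ).contDiff.comp_contDiffOn
        ((η.smooth x₀).fderiv_of_isOpen (isOpen_extChartAt_target x₀) (by simp))
    exact h1.congr fun y hy => localRep_extDerivAt η x₀ hy⟩

theorem d_add (η θ : Form q M) : d (η + θ) = d η + d θ := by
  refine Form.ext (funext fun x => ?_)
  change (_root_.extDeriv (localRep η.toFun x + localRep θ.toFun x)
    (extChartAt (𝓡 M.dim) x x)).compContinuousLinearMap
    (mfderiv (𝓡 M.dim) 𝓘(ℝ, M.Model) (extChartAt (𝓡 M.dim) x) x) = _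
  rw [extDeriv_add (differentiableAt_localRep η x) (differentiableAt_localRep θ x)]
  rfl

theorem d_smul (c : ℝ) (η : Form q M) : d (c • η) = c • d η := by
  refine Form.ext (funext fun x => ?_)
  change (_root_.extDeriv (c • localRep η.toFun x)
    (extChartAt (𝓡 M.dim) x x)).compContinuousLinearMap
    (mfderiv (𝓡 M.dim) 𝓘(ℝ, M.Model) (extChartAt (𝓡 M.dim) x) x) = _
  rw [extDeriv_smul]
  rfl

theorem d_d (η : Form q M) : d (d η) = 0 := by
  refine Form.ext (funext fun x => ?_)
  change (_root_.extDeriv (localRep (extDerivAt η) x)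
    (extChartAt (𝓡 M.dim) x x)).compContinuousLinearMap
    (mfderiv (𝓡 M.dim) 𝓘(ℝ, M.Model) (extChartAt (𝓡 M.dim) x) x) = _
  have he := Filter.EventuallyEq.extDeriv_eq (Filter.eventuallyEq_of_mem
    ((isOpen_extChartAt_target (I := 𝓡 M.dim) x).mem_nhds (mem_extChartAt_target x))
    fun y hy => localRep_extDerivAt η x hy)
  rw [he, extDeriv_extDeriv_apply ((η.smooth x).contDiffAt ((isOpen_extChartAt_target x).mem_nhds
    (mem_extChartAt_target x))) minSmoothness_two_le]
  rfl

theorem d_pullback (f : M ⟶ N) (η : Form q N) : d (pullback f η) = pullback f (d η) := by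
  refine Form.ext (funext fun x => ?_)
  have ho := isOpen_extChartAt_target (I := 𝓡 M.dim) x
  have hs := contMDiffOn_extChartAt_symm (I := 𝓡 M.dim) (n := ∞) x
  have hm : ∀ y ∈ (extChartAt (𝓡 M.dim) x).target, MDifferentiableAt 𝓘(ℝ, M.Model) (𝓡 M.dim)
      (extChartAt (𝓡 M.dim) x).symm y := fun y hy =>
    (hs.contMDiffAt (ho.mem_nhds hy)).mdifferentiableAt (by simp)
  have h1 : ∀ y ∈ (extChartAt (𝓡 M.dim) x).target,
      localRep (d (pullback f η)).toFun x y = localRep (pullback f (d η)).toFun x y := by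
    intro y hy
    refine (localRep_extDerivAt (pullback f η) x hy).trans ?_
    have he := Filter.EventuallyEq.extDeriv_eq (Filter.eventuallyEq_of_mem (ho.mem_nhds hy)
      fun z hz => plotPullback_pullback f η (hm z hz))
    refine he.trans ?_
    rw [extDeriv_plotPullback η ho (f.2.comp_contMDiffOn hs) hy]
    exact (plotPullback_pullback f (d η) (hm y hy)).symm
  have h2 := h1 _ (mem_extChartAt_target x)
  have hid : (extChartAt (𝓡 M.dim) x).symm ∘ (extChartAt (𝓡 M.dim) x) =ᶠ[𝓝 x] id :=
    Filter.eventuallyEq_of_mem (extChartAt_source_mem_nhds (I := 𝓡 M.dim) x)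
      fun z hz => (extChartAt (𝓡 M.dim) x).left_inv hz
  have hD : (mfderiv 𝓘(ℝ, M.Model) (𝓡 M.dim) (extChartAt (𝓡 M.dim) x).symm
      (extChartAt (𝓡 M.dim) x x)).comp
        (mfderiv (𝓡 M.dim) 𝓘(ℝ, M.Model) (extChartAt (𝓡 M.dim) x) x) =
      ContinuousLinearMap.id ℝ M.Model := by
    rw [← mfderiv_comp x (hm _ (mem_extChartAt_target x))
      (mdifferentiableAt_extChartAt (mem_chart_source _ _)), hid.mfderiv_eq]
    exact mfderiv_id
  have key : ∀ η : Form (q + 1) M, (localRep η.toFun x (extChartAt (𝓡 M.dim) x x)).compContinuousLinearMap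
      (mfderiv (𝓡 M.dim) 𝓘(ℝ, M.Model) (extChartAt (𝓡 M.dim) x) x) = η.toFun x := by
    intro η
    have e1 : ∀ (x' : M) (_ : x' = x), (η.toFun x').compContinuousLinearMap
        (show TangentSpace (𝓡 M.dim) x →L[ℝ] TangentSpace (𝓡 M.dim) x' from
          ContinuousLinearMap.id ℝ M.Model) = η.toFun x := by
      rintro _ rfl
      rfl
    rw [← e1 _ (extChartAt_to_inv (I := 𝓡 M.dim) x), ← hD]
    rfl
  rw [← key, ← key, h2]

theorem pullback_id (η : Form q M) : pullback (𝟙 M) η = η := by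
  refine Form.ext (funext fun x => ?_)
  change (η.toFun x).compContinuousLinearMap (mfderiv (𝓡 M.dim) (𝓡 M.dim) id x) = _
  rw [mfderiv_id]
  rfl

theorem pullback_comp (f : M ⟶ N) (g : N ⟶ P) (η : Form q P) :
    pullback (f ≫ g) η = pullback f (pullback g η) := by
  refine Form.ext (funext fun x => ?_)
  change (η.toFun (g.1 (f.1 x))).compContinuousLinearMap
    (mfderiv (𝓡 M.dim) (𝓡 P.dim) (g.1 ∘ f.1) x) = _
  rw [mfderiv_comp x (g.2.mdifferentiable (by simp) _) (f.2.mdifferentiable (by simp) _)]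
  rfl

theorem pullback_add (f : M ⟶ N) (η θ : Form q N) :
    pullback f (η + θ) = pullback f η + pullback f θ := rfl

theorem pullback_smul (f : M ⟶ N) (c : ℝ) (η : Form q N) :
    pullback f (c • η) = c • pullback f η := rfl

theorem pullback_neg (f : M ⟶ N) (η : Form q N) : pullback f (-η) = -pullback f η := rfl

theorem pullback_zero (f : M ⟶ N) : pullback f (0 : Form q N) = 0 := rfl

/-- The constant function `1` as a `0`-form. -/
def one (M : Man) : Form 0 M :=
  ⟨fun x => ContinuousAlternatingMap.constOfIsEmpty ℝ (TangentSpace (𝓡 M.dim) x) (Fin 0) (1 : ℝ),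
    fun _ => contDiffOn_const
        (c := ContinuousAlternatingMap.constOfIsEmpty ℝ M.Model (Fin 0) (1 : ℝ))⟩

theorem pullback_one (f : M ⟶ N) : pullback f (one N) = one M := rfl

/-- The exterior product of differential forms on a manifold. -/
def wedge (η : Form p M) (θ : Form q M) : Form (p + q) M :=
  ⟨fun x => wedgeAt (E := M.Model) (η.toFun x) (θ.toFun x), fun x₀ => by
    have h1 : ContDiffOn ℝ ∞ (fun y => (LinearMap.toContinuousBilinearMap
        (wedgeBilin (E := M.Model) (p := p) (q := q))) (localRep η.toFun x₀ y) (localRep θ.toFun x₀ y))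
        (extChartAt (𝓡 M.dim) x₀).target :=
      ContDiffOn.clm_apply ((ContinuousLinearMap.contDiff _).comp_contDiffOn (η.smooth x₀))
        (θ.smooth x₀)
    refine h1.congr fun y _ => ?_
    exact wedgeAt_comp (E := M.Model) (F := M.Model) (η.toFun _) (θ.toFun _) _⟩

theorem pullback_wedge (f : M ⟶ N) (η : Form p N) (θ : Form q N) :
    pullback f (wedge η θ) = wedge (pullback f η) (pullback f θ) :=
  Form.ext (funext fun x => wedgeAt_comp (E := M.Model) (F := N.Model) (η.toFun (f.1 x)) (θ.toFun (f.1 x))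
    (mfderiv (𝓡 M.dim) (𝓡 N.dim) f.1 x))

end Form

/-- The presheaf `Ω^q` on manifolds, `M ↦ Ω^q(M)`. For a presheaf `F` on manifolds,
`F ⟶ Omega q` (natural transformations of set-valued presheaves) is the space `Ω^q(F)` of
`q`-forms on `F`. -/
def Omega (q : ℕ) : Manᵒᵖ ⥤ Type where
  obj M := Form q M.unop
  map f := ↾(Form.pullback f.unop)
  map_id M := by
    refine ConcreteCategory.hom_ext _ _ fun η => ?_
    exact Form.pullback_id η
  map_comp f g := by
    refine ConcreteCategory.hom_ext _ _ fun η => ?_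
    exact Form.pullback_comp g.unop f.unop η

namespace Omega

variable {F : Manᵒᵖ ⥤ Type} {p q : ℕ}

/-- Constructor for `q`-forms on `F` from a natural family of maps. -/
def mk (t : ∀ M : Man, F.obj (op M) → Form q M)
    (ht : ∀ ⦃M N : Man⦄ (f : M ⟶ N) (s : F.obj (op N)),
      t M (F.map f.op s) = Form.pullback f (t N s)) : F ⟶ Omega q where
  app M := ↾(t M.unop)
  naturality M N f := by
    ext s
    exact ht f.unop s

/-- The value in `Ω^q(M)` of a `q`-form on `F` at `s ∈ F(M)`. -/
def eval (τ : F ⟶ Omega q) (M : Man) (s : F.obj (op M)) : Form q M := τ.app (op M) s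

theorem eval_naturality (τ : F ⟶ Omega q) {M N : Man} (f : M ⟶ N) (s : F.obj (op N)) :
    eval τ M (F.map f.op s) = Form.pullback f (eval τ N s) :=
  ConcreteCategory.congr_hom (τ.naturality f.op) s

theorem hom_ext {τ τ' : F ⟶ Omega q} (h : ∀ M s, eval τ M s = eval τ' M s) : τ = τ' := by
  ext M s
  exact h M.unop s

instance : Zero (F ⟶ Omega q) := ⟨mk (fun _ _ => 0) fun _ _ _ _ => rfl⟩

instance : Add (F ⟶ Omega q) :=
  ⟨fun τ τ' => mk (fun M s => eval τ M s + eval τ' M s) fun M N f s => by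
    rw [eval_naturality, eval_naturality, Form.pullback_add]⟩

instance : SMul ℝ (F ⟶ Omega q) :=
  ⟨fun c τ => mk (fun M s => c • eval τ M s) fun M N f s => by
    rw [eval_naturality, Form.pullback_smul]⟩

instance : Neg (F ⟶ Omega q) :=
  ⟨fun τ => mk (fun M s => -eval τ M s) fun M N f s => by
    rw [eval_naturality, Form.pullback_neg]⟩

theorem eval_add (τ τ' : F ⟶ Omega q) (M : Man) (s : F.obj (op M)) :
    eval (τ + τ') M s = eval τ M s + eval τ' M s := rfl

theorem eval_smul (c : ℝ) (τ : F ⟶ Omega q) (M : Man) (s : F.obj (op M)) :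
    eval (c • τ) M s = c • eval τ M s := rfl

theorem eval_zero (M : Man) (s : F.obj (op M)) : eval (0 : F ⟶ Omega q) M s = 0 := rfl

instance : AddCommGroup (F ⟶ Omega q) where
  add_assoc a b c := hom_ext fun M s => add_assoc _ _ _
  zero_add a := hom_ext fun M s => zero_add _
  add_zero a := hom_ext fun M s => add_zero _
  add_comm a b := hom_ext fun M s => add_comm _ _
  neg_add_cancel a := hom_ext fun M s => neg_add_cancel (eval a M s)
  nsmul := nsmulRec
  zsmul := zsmulRec

instance : Module ℝ (F ⟶ Omega q) where
  one_smul _ := hom_ext fun _ _ => one_smul _ _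
  mul_smul _ _ _ := hom_ext fun _ _ => mul_smul _ _ _
  smul_zero _ := hom_ext fun _ _ => smul_zero _
  smul_add _ _ _ := hom_ext fun _ _ => smul_add _ _ _
  add_smul _ _ _ := hom_ext fun _ _ => add_smul _ _ _
  zero_smul _ := hom_ext fun _ _ => zero_smul _ _

/-- The constant `0`-form `1` on a presheaf. -/
def one : F ⟶ Omega 0 := mk (fun M _ => Form.one M) fun _ _ f _ => (Form.pullback_one f).symm

/-- The exterior product of forms on a presheaf. -/
def wedge (σ : F ⟶ Omega p) (τ : F ⟶ Omega q) : F ⟶ Omega (p + q) :=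
  mk (fun M s => Form.wedge (eval σ M s) (eval τ M s)) fun M N f s => by
    rw [eval_naturality, eval_naturality, Form.pullback_wedge]

/-- The exterior power `τ ∧ ⋯ ∧ τ` (`k` factors) of a form on a presheaf. -/
def wedgePow (τ : F ⟶ Omega p) : ∀ k : ℕ, F ⟶ Omega (p * k)
  | 0 => one
  | k + 1 => wedge (wedgePow τ k) τ

/-- The exterior derivative as a map of presheaves `Ω^q ⟶ Ω^(q+1)`. -/
def d (q : ℕ) : Omega q ⟶ Omega (q + 1) :=
  mk (fun _ η => Form.d η) fun _ _ f η => Form.d_pullback f η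

/-- The exterior derivative `Ω^q(F) → Ω^(q+1)(F)` of forms on a presheaf. -/
def dLinear (F : Manᵒᵖ ⥤ Type) (q : ℕ) : (F ⟶ Omega q) →ₗ[ℝ] (F ⟶ Omega (q + 1)) where
  toFun τ := τ ≫ d q
  map_add' _ _ := hom_ext fun _ _ => Form.d_add _ _
  map_smul' _ _ := hom_ext fun _ _ => Form.d_smul _ _

/-- The tautological `q`-form on the presheaf `Ω^q`. -/
def taut (q : ℕ) : Omega q ⟶ Omega q := 𝟙 _

end Omega

/-- The de Rham complex `Ω^0(F) → Ω^1(F) → Ω^2(F) → ⋯` of a presheaf `F` on manifolds. -/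
def deRhamComplex (F : Manᵒᵖ ⥤ Type) : CochainComplex (ModuleCat.{1} ℝ) ℕ :=
  CochainComplex.of (fun q => ModuleCat.of ℝ (F ⟶ Omega q))
    (fun q => ModuleCat.ofHom (Omega.dLinear F q)) fun q => by
      refine ModuleCat.hom_ext (LinearMap.ext fun τ => ?_)
      exact Omega.hom_ext fun M s => Form.d_d (Omega.eval τ M s)

/-- The complex `ℝ → ℝ → ℝ → ℝ → ⋯` whose differentials are alternately `0` and `1`, the first
one being `0`. (`ULift` only adjusts the universe.) -/
def alternatingComplex : CochainComplex (ModuleCat.{1} ℝ) ℕ :=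
  CochainComplex.of (fun _ => ModuleCat.of ℝ (ULift.{1} ℝ))
    (fun q => if Odd q then 𝟙 _ else 0) fun q => by
      by_cases h : Odd q <;> simp [h, Nat.odd_add_one]

end

noncomputable section

/-! A form on the presheaf `Ω^1` is determined by one universal family of values. Every point of a
manifold lies on a smooth map from a vector space with surjective derivative, so forms on vector
spaces suffice. There a 1-form `∑ a_i dx_i` is the pullback of the Liouville form `λ = ∑ y_i dx_i`
along `x ↦ (x, a(x))`, so `τ` is known once every `τ(λ)` is (`eq_zero_of_univ`).

The upper bound on the dimension comes from the symmetries of `λ`. For a matrix `B`, the maps `(x,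
y) ↦ (Bx + c, y)` and `(x, y) ↦ (x, Bᵀy)` pull the two Liouville forms back to the same form, which
gives the identity `univ_mulVec`. Taking `B = 1` gives invariance under translation in `x`. Diagonal
`B` makes the coefficients of `τ(λ)` homogeneous in `y` and excludes any `dy_i` without `dx_i`. A
`B` that merges two coordinates excludes two unpaired `dx_i`, `dx_j`. Up to relabelling and sign one
monomial survives, `dx_0 dy_0 dx_1 dy_1 ⋯`, so a single number determines `τ`
(`stdCoeff_injective`).

For the lower bound, `(dω)^k` takes the constant value `(∑ dy_i ∧ dx_i)^k` on `λ`. It is positive on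
`y_0, x_0, y_1, x_1, …`, because only permutations of whole pairs contribute and these are even.
Constancy gives `d(dω)^k = 0`. Linearity of `λ` in the base point gives `d(ω ∧ (dω)^k) =
(dω)^(k+1)`, so the odd generators are nonzero too. In coordinates relative to the generators the de
Rham complex is then the alternating one. -/

/-- The manifold `ℝ^n`. -/
abbrev Man.euclid (n : ℕ) : Man := { carrier := EuclideanSpace ℝ (Fin n), dim := n }

namespace Form

variable {q : ℕ}

theorem localRep_euclid {n : ℕ}
    (a : EuclideanSpace ℝ (Fin n) → EuclideanSpace ℝ (Fin n) [⋀^Fin q]→L[ℝ] ℝ)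
    (x₀ : Man.euclid n) : localRep (M := Man.euclid n) a x₀ = a := by
  funext y
  change (a y).compContinuousLinearMap
    (mfderiv 𝓘(ℝ, EuclideanSpace ℝ (Fin n)) 𝓘(ℝ, EuclideanSpace ℝ (Fin n)) id y) = a y
  rw [mfderiv_id]
  rfl

/-- A smooth field of alternating forms on `ℝ^n` as a differential form. -/
def ofFun {n : ℕ} (a : EuclideanSpace ℝ (Fin n) → EuclideanSpace ℝ (Fin n) [⋀^Fin q]→L[ℝ] ℝ)
    (ha : ContDiff ℝ ∞ a) : Form q (Man.euclid n) :=
  ⟨a, fun x₀ => by rw [localRep_euclid]; exact ha.contDiffOn⟩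

end Form

/-! ### Evaluating a form on `Ω^p` at forms on vector spaces -/

section PlotEval

variable {E E' : Type*} [NormedAddCommGroup E] [NormedSpace ℝ E] [FiniteDimensional ℝ E]
  [NormedAddCommGroup E'] [NormedSpace ℝ E'] [FiniteDimensional ℝ E'] {p q : ℕ} {M : Man}

theorem contDiff_plotPullback (η : Form q M) {h : E → M}
    (hh : ContMDiff 𝓘(ℝ, E) (𝓡 M.dim) ∞ h) : ContDiff ℝ ∞ (plotPullback η.toFun h) :=
  contDiffOn_univ.1 (contDiffOn_plotPullback η.toFun η.smooth isOpen_univ hh.contMDiffOn)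

/-- A form on `E` transported to the Euclidean space isomorphic to `E`. -/
def euclidForm (α : E → E [⋀^Fin q]→L[ℝ] ℝ) (hα : ContDiff ℝ ∞ α) :
    Form q (Man.euclid (Module.finrank ℝ E)) :=
  Form.ofFun (fun z => (α ((toEuclidean (E := E)).symm z)).compContinuousLinearMap
      ((toEuclidean (E := E)).symm : EuclideanSpace ℝ (Fin (Module.finrank ℝ E)) →L[ℝ] E)) <|
    contDiffOn_univ.1 <| contDiffOn_comp
      (hα.comp (toEuclidean (E := E)).symm.contDiff).contDiffOn contDiffOn_const

theorem contMDiff_toEuclidean : ContMDiff 𝓘(ℝ, E) (𝓡 (Man.euclid (Module.finrank ℝ E)).dim) ∞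
    (toEuclidean (E := E) : E → Man.euclid (Module.finrank ℝ E)) :=
  (toEuclidean (E := E)).contDiff.contMDiff

theorem plotPullback_euclidForm (α : E → E [⋀^Fin q]→L[ℝ] ℝ) (hα : ContDiff ℝ ∞ α) :
    plotPullback (euclidForm α hα).toFun (toEuclidean (E := E)) = α := by
  funext y
  change ((α ((toEuclidean (E := E)).symm (toEuclidean y))).compContinuousLinearMap _).compContinuousLinearMap
    (mfderiv 𝓘(ℝ, E) 𝓘(ℝ, EuclideanSpace ℝ (Fin (Module.finrank ℝ E))) _ _) = α y
  rw [mfderiv_eq_fderiv, ContinuousLinearEquiv.fderiv]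
  ext v
  refine congrArg (fun w => α _ w) (funext fun i => ?_) |>.trans (congrArg (fun x => α x v) ?_)
  · exact (toEuclidean (E := E)).symm_apply_apply (v i)
  · exact (toEuclidean (E := E)).symm_apply_apply y

/-- The value of a `q`-form `τ` on the presheaf `Ω^p` at a smooth `p`-form on a finite dimensional
vector space. -/
def plotEval (τ : Omega p ⟶ Omega q) (α : E → E [⋀^Fin p]→L[ℝ] ℝ) (hα : ContDiff ℝ ∞ α) :
    E → E [⋀^Fin q]→L[ℝ] ℝ :=
  plotPullback (Omega.eval τ _ (euclidForm α hα)).toFun (toEuclidean (E := E))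

theorem plotEval_congr (τ : Omega p ⟶ Omega q) {α β : E → E [⋀^Fin p]→L[ℝ] ℝ}
    (hα : ContDiff ℝ ∞ α) (hβ : ContDiff ℝ ∞ β) (h : α = β) :
    plotEval τ α hα = plotEval τ β hβ := by
  subst h
  rfl

theorem contDiff_plotEval (τ : Omega p ⟶ Omega q) (α : E → E [⋀^Fin p]→L[ℝ] ℝ)
    (hα : ContDiff ℝ ∞ α) : ContDiff ℝ ∞ (plotEval τ α hα) :=
  contDiff_plotPullback _ contMDiff_toEuclidean

/-- Transporting `h` to Euclidean space makes it a morphism of `Man`, to which naturality of `τ`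
applies. This is the bridge from arbitrary manifolds to vector spaces. -/
theorem plotPullback_eval (τ : Omega p ⟶ Omega q) (η : Form p M) {h : E → M}
    (hh : ContMDiff 𝓘(ℝ, E) (𝓡 M.dim) ∞ h) :
    plotPullback (Omega.eval τ M η).toFun h =
      plotEval τ (plotPullback η.toFun h) (contDiff_plotPullback η hh) := by
  let e := toEuclidean (E := E)
  have he : ∀ y, MDifferentiableAt 𝓘(ℝ, E) (𝓡 (Man.euclid (Module.finrank ℝ E)).dim)
      (e : E → Man.euclid (Module.finrank ℝ E)) y :=
    contMDiff_toEuclidean.mdifferentiable (by simp)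
  let f : Man.euclid (Module.finrank ℝ E) ⟶ M := ⟨h ∘ e.symm, hh.comp e.symm.contDiff.contMDiff⟩
  have hfe : f.1 ∘ e = h := funext fun y => congrArg h (e.symm_apply_apply y)
  have h1 : Form.pullback f η = euclidForm (plotPullback η.toFun h) (contDiff_plotPullback η hh) := by
    refine Form.ext (funext fun z => ?_)
    change (η.toFun (h (e.symm z))).compContinuousLinearMap
      (mfderiv 𝓘(ℝ, EuclideanSpace ℝ (Fin (Module.finrank ℝ E))) (𝓡 M.dim) (h ∘ e.symm) z) = _
    rw [mfderiv_comp z (hh.mdifferentiable (by simp) _)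
      (e.symm.contDiff.contMDiff.mdifferentiable (n := ∞) (by simp) _), mfderiv_eq_fderiv,
      ContinuousLinearEquiv.fderiv]
    rfl
  funext y
  have h2 := Form.plotPullback_pullback f (Omega.eval τ M η) (he y)
  rw [hfe] at h2
  refine h2.symm.trans ?_
  exact congrArg (fun θ : Form q (Man.euclid (Module.finrank ℝ E)) => plotPullback θ.toFun e y)
    ((Omega.eval_naturality τ f η).symm.trans (congrArg (Omega.eval τ _) h1))

omit [FiniteDimensional ℝ E'] in
theorem contDiff_pullback {α : E' → E' [⋀^Fin q]→L[ℝ] ℝ} (hα : ContDiff ℝ ∞ α) {h : E → E'}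
    (hh : ContDiff ℝ ∞ h) :
    ContDiff ℝ ∞ fun y => (α (h y)).compContinuousLinearMap (fderiv ℝ h y) :=
  contDiffOn_univ.1 <| contDiffOn_comp (hα.comp hh).contDiffOn
    (hh.fderiv_right (m := ∞) (by simp)).contDiffOn

/-- Naturality of `τ` for smooth maps of vector spaces. Since `β` is only required to agree
pointwise with the pullback of `α`, one form can be presented as a pullback in two ways and the
results compared. -/
theorem plotEval_pullback (τ : Omega p ⟶ Omega q) {α : E' → E' [⋀^Fin p]→L[ℝ] ℝ}
    (hα : ContDiff ℝ ∞ α) {β : E → E [⋀^Fin p]→L[ℝ] ℝ} (hβ : ContDiff ℝ ∞ β) {h : E → E'}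
    (hh : ContDiff ℝ ∞ h)
    (hαβ : ∀ y, (α (h y)).compContinuousLinearMap (fderiv ℝ h y) = β y) (y : E) :
    plotEval τ β hβ y =
      (plotEval τ α hα (h y)).compContinuousLinearMap (fderiv ℝ h y) := by
  have hs : ContMDiff 𝓘(ℝ, E) (𝓡 (Man.euclid (Module.finrank ℝ E')).dim) ∞
      ((toEuclidean (E := E') : E' → Man.euclid (Module.finrank ℝ E')) ∘ h) :=
    contMDiff_toEuclidean.comp hh.contMDiff
  have hc : ∀ (r : ℕ) (η : Form r (Man.euclid (Module.finrank ℝ E'))) (y : E),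
      plotPullback η.toFun (toEuclidean (E := E') ∘ h) y =
        (plotPullback η.toFun (toEuclidean (E := E')) (h y)).compContinuousLinearMap
          (fderiv ℝ h y) := fun r η y =>
    plotPullback_comp η.toFun (hh.differentiable (by simp) y)
      (contMDiff_toEuclidean.mdifferentiable (by simp) _)
  refine Eq.trans ?_ (hc q (Omega.eval τ _ (euclidForm α hα)) y)
  refine Eq.trans ?_ (congrFun (plotPullback_eval τ (euclidForm α hα) hs) y).symm
  refine congrFun (plotEval_congr τ _ _ (funext fun z => ?_)) y
  rw [hc, plotPullback_euclidForm, hαβ]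

theorem plotEval_taut (α : E → E [⋀^Fin q]→L[ℝ] ℝ) (hα : ContDiff ℝ ∞ α) :
    plotEval (Omega.taut q) α hα = α :=
  plotPullback_euclidForm α hα

theorem plotEval_dLinear (τ : Omega p ⟶ Omega q) (α : E → E [⋀^Fin p]→L[ℝ] ℝ)
    (hα : ContDiff ℝ ∞ α) (y : E) :
    plotEval (Omega.dLinear (Omega p) q τ) α hα y = extDeriv (plotEval τ α hα) y :=
  (Form.extDeriv_plotPullback _ isOpen_univ contMDiff_toEuclidean.contMDiffOn
    (Set.mem_univ y)).symm

theorem plotEval_wedge {r : ℕ} (σ : Omega p ⟶ Omega q) (τ : Omega p ⟶ Omega r)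
    (α : E → E [⋀^Fin p]→L[ℝ] ℝ) (hα : ContDiff ℝ ∞ α) (y : E) :
    plotEval (Omega.wedge σ τ) α hα y = wedgeAt (plotEval σ α hα y) (plotEval τ α hα y) :=
  wedgeAt_comp (F := EuclideanSpace ℝ (Fin (Module.finrank ℝ E))) _ _ _

/-- Every point of `M` lies on a smooth map from the model space to `M` with surjective derivative
there. -/
theorem exists_plot (x : M) : ∃ h : M.Model → M, ContMDiff 𝓘(ℝ, M.Model) (𝓡 M.dim) ∞ h ∧
    ∃ y, h y = x ∧ Function.Surjective (mfderiv 𝓘(ℝ, M.Model) (𝓡 M.dim) h y) := by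
  set φ := extChartAt (𝓡 M.dim) x with hφ
  set c : M.Model := φ x with hc
  have ho : IsOpen φ.target := isOpen_extChartAt_target x
  obtain ⟨r, hr, hball⟩ := Metric.isOpen_iff.1 ho c (mem_extChartAt_target x)
  -- The map `g` squeezes the whole model space into the ball of radius `r` inside the chart target
  -- and is the identity near `c`, so the inverse chart extends to a globally defined map with the
  -- same germ at `c`.
  let b : ContDiffBump c := ⟨r / 4, r / 2, by positivity, by linarith⟩
  let g : M.Model → M.Model := fun z => c + b z • (z - c)
  have hg : ContDiff ℝ ∞ g := by
    exact contDiff_const.add (b.contDiff.smul (contDiff_id.sub contDiff_const))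
  have hgt : ∀ z, g z ∈ φ.target := fun z => hball <| by
    rw [Metric.mem_ball, dist_eq_norm, add_sub_cancel_left, norm_smul, Real.norm_eq_abs,
      abs_of_nonneg b.nonneg]
    by_cases hz : dist z c < r / 2
    · rw [dist_eq_norm] at hz
      nlinarith [b.le_one (x := z), b.nonneg (x := z), norm_nonneg (z - c)]
    · rw [b.zero_of_le_dist (not_lt.1 hz), zero_mul]
      exact hr
  have hgid : g =ᶠ[𝓝 c] id := by
    filter_upwards [b.eventuallyEq_one] with z hz
    simp [g, hz]
  have hs := contMDiffOn_extChartAt_symm (I := 𝓡 M.dim) (n := ∞) x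
  have hφx : φ.symm c = x := φ.left_inv (mem_extChartAt_source x)
  refine ⟨φ.symm ∘ g, ?_, c, ?_, ?_⟩
  · rw [← contMDiffOn_univ]
    exact hs.comp hg.contMDiff.contMDiffOn fun z _ => hgt z
  · rw [Function.comp_apply, hgid.self_of_nhds, id, hφx]
  · have he : φ.symm ∘ g =ᶠ[𝓝 c] φ.symm := by
      filter_upwards [hgid] with z hz
      rw [Function.comp_apply, hz, id]
    rw [he.mfderiv_eq]
    have h1 : φ.symm ∘ φ =ᶠ[𝓝 x] id :=
      Filter.eventuallyEq_of_mem (extChartAt_source_mem_nhds (I := 𝓡 M.dim) x)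
        fun z hz => φ.left_inv hz
    have hD : (mfderiv 𝓘(ℝ, M.Model) (𝓡 M.dim) φ.symm c).comp
        (mfderiv (𝓡 M.dim) 𝓘(ℝ, M.Model) φ x) = ContinuousLinearMap.id ℝ M.Model := by
      rw [← mfderiv_comp x ((hs.contMDiffAt (ho.mem_nhds (mem_extChartAt_target x))).mdifferentiableAt
        (by simp)) (mdifferentiableAt_extChartAt (mem_chart_source _ _)), h1.mfderiv_eq]
      exact mfderiv_id
    intro v
    exact ⟨_, DFunLike.congr_fun hD v⟩

/-- Pullback along a map with surjective derivative at a point is injective on alternating forms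
there, so the maps of `exists_plot` detect every value of `τ`. -/
theorem Omega.eq_zero_of_plotEval (τ : Omega p ⟶ Omega q)
    (H : ∀ (n : ℕ) (α : EuclideanSpace ℝ (Fin n) → EuclideanSpace ℝ (Fin n) [⋀^Fin p]→L[ℝ] ℝ)
      (hα : ContDiff ℝ ∞ α) y, plotEval τ α hα y = 0) : τ = 0 := by
  refine Omega.hom_ext fun M η => Form.ext (funext fun x => ?_)
  obtain ⟨h, hh, y, rfl, hy⟩ := exists_plot x
  have h1 := congrFun (plotPullback_eval τ η hh) y
  rw [H] at h1
  ext v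
  choose w hw using fun i => hy (v i)
  have h2 := DFunLike.congr_fun h1 w
  rw [Omega.eval_zero, Form.zero_toFun, ← funext hw]
  exact h2

end PlotEval

/-! ### The Liouville form and the upper bound on the dimension -/

section Liouville

variable {ι κ : Type} [Fintype ι] [Fintype κ] {q : ℕ}

/-- The bilinear form `((x, y), (x', y')) ↦ ∑ i, y i * x' i`. -/
def liouvillePairing (ι : Type) [Fintype ι] :
    ((ι → ℝ) × (ι → ℝ)) →L[ℝ] ((ι → ℝ) × (ι → ℝ)) →L[ℝ] ℝ :=
  ∑ i, ((ContinuousLinearMap.proj (R := ℝ) (φ := fun _ : ι => ℝ) i).comp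
    (ContinuousLinearMap.snd ℝ _ _)).smulRight
      ((ContinuousLinearMap.proj (R := ℝ) (φ := fun _ : ι => ℝ) i).comp
        (ContinuousLinearMap.fst ℝ _ _))

theorem liouvillePairing_apply (p v : (ι → ℝ) × (ι → ℝ)) :
    liouvillePairing ι p v = p.2 ⬝ᵥ v.1 := by
  simp [liouvillePairing, dotProduct]

/-- The Liouville form `∑ i, y i dx i` as a linear map to alternating forms. -/
def liouvilleCLM (ι : Type) [Fintype ι] :
    ((ι → ℝ) × (ι → ℝ)) →L[ℝ] ((ι → ℝ) × (ι → ℝ)) [⋀^Fin 1]→L[ℝ] ℝ :=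
  (ContinuousAlternatingMap.ofSubsingletonLIE (𝕜 := ℝ) (E := (ι → ℝ) × (ι → ℝ)) (F := ℝ)
    (0 : Fin 1)).toContinuousLinearEquiv.toContinuousLinearMap.comp (liouvillePairing ι)

/-- The Liouville form `∑ i, y i dx i` on `ℝ^ι × ℝ^ι`. -/
def liouville (ι : Type) [Fintype ι] (p : (ι → ℝ) × (ι → ℝ)) :
    ((ι → ℝ) × (ι → ℝ)) [⋀^Fin 1]→L[ℝ] ℝ := liouvilleCLM ι p

theorem liouville_apply (p : (ι → ℝ) × (ι → ℝ)) (v : Fin 1 → (ι → ℝ) × (ι → ℝ)) :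
    liouville ι p v = p.2 ⬝ᵥ (v 0).1 :=
  liouvillePairing_apply p (v 0)

theorem contDiff_liouville (ι : Type) [Fintype ι] : ContDiff ℝ ∞ (liouville ι) :=
  (liouvilleCLM ι).contDiff

namespace Omega

/-- The value of a `q`-form on the presheaf `Ω^1` at the Liouville form. -/
def univ (τ : Omega 1 ⟶ Omega q) (ι : Type) [Fintype ι] (p : (ι → ℝ) × (ι → ℝ)) :
    ((ι → ℝ) × (ι → ℝ)) [⋀^Fin q]→L[ℝ] ℝ :=
  plotEval τ (liouville ι) (contDiff_liouville ι) p

theorem continuous_univ (τ : Omega 1 ⟶ Omega q) : Continuous (univ τ ι) :=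
  (contDiff_plotEval τ _ _).continuous

/-- Every `1`-form is a pullback of a Liouville form, so a form on `Ω^1` is determined by its
values there. -/
theorem eq_zero_of_univ (τ : Omega 1 ⟶ Omega q) (H : ∀ n p, univ τ (Fin n) p = 0) : τ = 0 := by
  refine eq_zero_of_plotEval τ fun n α hα y => ?_
  let b := EuclideanSpace.basisFun (Fin n) ℝ
  let e : EuclideanSpace ℝ (Fin n) →L[ℝ] (Fin n → ℝ) := EuclideanSpace.equiv (Fin n) ℝ
  -- These are the coefficients of `α`; the graph map `z ↦ (z, g z)` pulls the Liouville form back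
  -- to `α`.
  let g : EuclideanSpace ℝ (Fin n) → Fin n → ℝ := fun z i => α z fun _ => b i
  have hg : ContDiff ℝ ∞ g := contDiff_pi.2 fun i =>
    (ContinuousAlternatingMap.apply ℝ (EuclideanSpace ℝ (Fin n)) ℝ
      (fun _ : Fin 1 => b i)).contDiff.comp hα
  have hd : ∀ z, HasFDerivAt (fun z => (e z, g z)) (e.prod (fderiv ℝ g z)) z := fun z =>
    e.hasFDerivAt.prodMk (hg.differentiable (by simp) z).hasFDerivAt
  rw [plotEval_pullback τ (contDiff_liouville (Fin n)) hα (h := fun z => (e z, g z))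
    (e.contDiff.prodMk hg)]
  · change (univ τ (Fin n) _).compContinuousLinearMap _ = 0
    rw [H]
    rfl
  · intro z
    rw [(hd z).fderiv]
    ext v
    have hv : v = fun _ => v 0 := funext fun i => congrArg v (Subsingleton.elim i 0)
    rw [ContinuousAlternatingMap.compContinuousLinearMap_apply, liouville_apply, hv]
    have h1 : v 0 = ∑ i, v 0 i • b i := by
      simpa [b] using (b.sum_repr (v 0)).symm
    have h2 : ∀ w, α z (fun _ => w) =
      (ContinuousAlternatingMap.ofSubsingleton ℝ (EuclideanSpace ℝ (Fin n)) ℝ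
        (0 : Fin 1)).symm (α z) w := fun w => rfl
    rw [h2]
    nth_rw 2 [h1]
    rw [map_sum]
    refine Finset.sum_congr rfl fun i _ => ?_
    rw [map_smul, smul_eq_mul, mul_comm]
    rfl

/-- On `ℝ^κ × ℝ^ι` the form `y ⬝ B dx` is the pullback of the Liouville form of `ι` along `(x, y) ↦
(Bx + c, y)` and of that of `κ` along `(x, y) ↦ (x, yB)`. Naturality along both maps, compared at
`(0, y)`, gives the identity. All constraints on the coefficients are instances of it. -/
theorem univ_mulVec (τ : Omega 1 ⟶ Omega q) (B : Matrix ι κ ℝ) (c y : ι → ℝ)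
    (v : Fin q → (κ → ℝ) × (ι → ℝ)) :
    univ τ ι (c, y) (fun m => (B.mulVec (v m).1, (v m).2)) =
      univ τ κ (0, Matrix.vecMul y B) (fun m => ((v m).1, Matrix.vecMul (v m).2 B)) := by
  let L : (κ → ℝ) →L[ℝ] (ι → ℝ) := B.mulVecLin.toContinuousLinearMap
  let R : (ι → ℝ) →L[ℝ] (κ → ℝ) := B.vecMulLinear.toContinuousLinearMap
  let A₁ : ((κ → ℝ) × (ι → ℝ)) →L[ℝ] (ι → ℝ) × (ι → ℝ) :=
    L.prodMap (ContinuousLinearMap.id ℝ _)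
  let A₂ : ((κ → ℝ) × (ι → ℝ)) →L[ℝ] (κ → ℝ) × (κ → ℝ) :=
    (ContinuousLinearMap.id ℝ _).prodMap R
  let h₁ : (κ → ℝ) × (ι → ℝ) → (ι → ℝ) × (ι → ℝ) := fun p => A₁ p + (c, 0)
  have hh₁ : ContDiff ℝ ∞ h₁ := A₁.contDiff.add contDiff_const
  have hd₁ : ∀ p, fderiv ℝ h₁ p = A₁ := fun p => (A₁.hasFDerivAt.add_const (c, 0)).fderiv
  have e₁ := plotEval_pullback τ (contDiff_liouville ι)
    (contDiff_pullback (contDiff_liouville ι) hh₁) hh₁ (fun _ => rfl) (0, y)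
  have e₂ := plotEval_pullback τ (contDiff_liouville κ)
    (contDiff_pullback (contDiff_liouville ι) hh₁) A₂.contDiff (fun p => by
      rw [hd₁, ContinuousLinearMap.fderiv]
      ext w
      change liouville κ (A₂ p) (fun i => A₂ (w i)) = liouville ι (h₁ p) (fun i => A₁ (w i))
      rw [liouville_apply, liouville_apply]
      change Matrix.vecMul p.2 B ⬝ᵥ (w 0).1 = (p.2 + 0) ⬝ᵥ B.mulVec (w 0).1
      rw [add_zero, Matrix.dotProduct_mulVec]) (0, y)
  rw [hd₁] at e₁
  rw [ContinuousLinearMap.fderiv] at e₂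
  have e := DFunLike.congr_fun (e₁.symm.trans e₂) v
  have hp : h₁ (0, y) = (c, y) := by
    refine Prod.ext ?_ ?_
    · change B.mulVec 0 + c = c
      rw [Matrix.mulVec_zero, zero_add]
    · exact add_zero y
  rw [hp] at e
  exact e

end Omega

variable [DecidableEq ι] [DecidableEq κ]

/-- The standard basis of `ℝ^ι × ℝ^ι`. -/
def darboux : ι ⊕ ι → (ι → ℝ) × (ι → ℝ) :=
  Sum.elim (fun i => (Pi.single i 1, 0)) (fun i => (0, Pi.single i 1))

theorem coe_basisFun_prod :
    ⇑((Pi.basisFun ℝ ι).prod (Pi.basisFun ℝ ι)) = darboux (ι := ι) := by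
  funext s
  rcases s with i | i <;> simp [darboux, Module.Basis.prod_apply]

namespace Omega

/-- The coefficients of `univ τ ι` at the points `(0, z)`. -/
def coeff (τ : Omega 1 ⟶ Omega q) (z : ι → ℝ) (u : Fin q → ι ⊕ ι) : ℝ :=
  univ τ ι (0, z) (darboux ∘ u)

theorem eq_zero_of_coeff (τ : Omega 1 ⟶ Omega q)
    (H : ∀ n (z : Fin n → ℝ) u, coeff τ z u = 0) : τ = 0 := by
  refine eq_zero_of_univ τ fun n p => ?_
  refine ContinuousAlternatingMap.toAlternatingMap_injective ?_
  refine Module.Basis.ext_alternating ((Pi.basisFun ℝ (Fin n)).prod (Pi.basisFun ℝ (Fin n)))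
    fun u _ => ?_
  rw [coe_basisFun_prod]
  -- With `B = 1` this is translation invariance in `x`, which moves the base point to `(0, p.2)`.
  have h := univ_mulVec τ 1 p.1 p.2 (darboux ∘ u)
  simp only [Matrix.one_mulVec, Matrix.vecMul_one, Prod.mk.eta] at h
  exact h.trans (H n p.2 u)

/-- The case `B = diagonal a`: one side rescales the `x`-vectors, the other the `y`-vectors and the
base point. Entries of `a` may be zero. -/
theorem coeff_scale (τ : Omega 1 ⟶ Omega q) (a z : ι → ℝ) (u : Fin q → ι ⊕ ι) :
    (∏ m, Sum.elim a (1 : ι → ℝ) (u m)) * coeff τ z u = (∏ m, Sum.elim (1 : ι → ℝ) a (u m)) * coeff τ (z * a) u := by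
  have h := univ_mulVec τ (Matrix.diagonal a) 0 z (darboux ∘ u)
  have h1 : Matrix.vecMul z (Matrix.diagonal a) = z * a := by
    ext i
    rw [Matrix.vecMul_diagonal, Pi.mul_apply]
  have h2 : ∀ s : ι ⊕ ι, ((Matrix.diagonal a).mulVec (darboux s).1, (darboux s).2) =
      Sum.elim a (1 : ι → ℝ) s • darboux s := by
    rintro (i | i) <;> ext j <;>
      by_cases hj : j = i <;> simp [darboux, Matrix.mulVec_diagonal, hj]
  have h3 : ∀ s : ι ⊕ ι, ((darboux s).1, Matrix.vecMul (darboux s).2 (Matrix.diagonal a)) =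
      Sum.elim (1 : ι → ℝ) a s • darboux s := by
    rintro (i | i) <;> ext j <;>
      by_cases hj : j = i <;> simp [darboux, Matrix.vecMul_diagonal, hj]
  simp only [Function.comp_apply, h1, h2, h3] at h
  have h4 := fun (f : ((ι → ℝ) × (ι → ℝ)) [⋀^Fin q]→L[ℝ] ℝ) (b : Fin q → ℝ) =>
    f.toMultilinearMap.map_smul_univ b (fun m => darboux (u m))
  simp only [smul_eq_mul] at h4
  exact (h4 _ _).symm.trans (h.trans (h4 _ _))

/-- The case where `B` is the 0-1 matrix of `j`, so that `B e_k = e_(j k)` and `y B = y ∘ j`.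
Injective `j` discards unused coordinates; non-injective `j` identifies coordinates. -/
theorem coeff_map (τ : Omega 1 ⟶ Omega q) (j : κ → ι) (z : ι → ℝ) (u : Fin q → κ ⊕ ι) :
    coeff τ z (Sum.map j id ∘ u) = univ τ κ (0, z ∘ j)
      (fun m => Sum.elim (fun k => (Pi.single k 1, 0))
        (fun i => (0, (Pi.single i 1 : ι → ℝ) ∘ j)) (u m)) := by
  let B : Matrix ι κ ℝ := Matrix.of fun i k => if i = j k then 1 else 0
  have hB : ∀ y : ι → ℝ, Matrix.vecMul y B = y ∘ j := by
    intro y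
    ext k
    simp [B, Matrix.vecMul, dotProduct]
  have hB' : ∀ k, B.mulVec (Pi.single k 1) = Pi.single (j k) 1 := by
    intro k
    ext i
    simp [B, Pi.single_apply]
  have h := univ_mulVec τ B 0 z (fun m => Sum.elim (fun k => (Pi.single k 1, 0))
        (fun i => (0, (Pi.single i 1 : ι → ℝ))) (u m))
  rw [hB] at h
  refine Eq.trans ?_ (h.trans ?_)
  · refine congrArg (univ τ ι (0, z)) (funext fun m => ?_)
    rcases hu : u m with k | i <;> simp [hu, darboux, hB']
  · refine congrArg (univ τ κ (0, z ∘ j)) (funext fun m => ?_)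
    rcases hu : u m with k | i <;> simp [hB]

theorem coeff_comp_map (τ : Omega 1 ⟶ Omega q) {j : κ → ι} (hj : j.Injective) (z : ι → ℝ)
    (u : Fin q → κ ⊕ κ) : coeff τ z (Sum.map j j ∘ u) = coeff τ (z ∘ j) u := by
  have h := coeff_map τ j z (Sum.map id j ∘ u)
  rw [← Function.comp_assoc, Sum.map_comp_map, Function.comp_id, Function.id_comp] at h
  rw [h]
  refine congrArg (univ τ κ (0, z ∘ j)) (funext fun m => ?_)
  rcases hu : u m with k | k
  · simp [hu, darboux]
  · have : (Pi.single (j k) 1 : ι → ℝ) ∘ j = Pi.single k 1 := by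
      ext l
      simp [Pi.single_apply, hj.eq_iff]
    simp [hu, darboux, this]

theorem continuous_coeff (τ : Omega 1 ⟶ Omega q) (u : Fin q → ι ⊕ ι) :
    Continuous fun z => coeff τ z u :=
  (ContinuousAlternatingMap.apply ℝ _ ℝ (darboux ∘ u)).continuous.comp
    ((continuous_univ τ).comp (by fun_prop))

/-- The vanishing of a coefficient need only be checked at `z = (1, …, 1)`. -/
theorem coeff_eq_zero_of_one (τ : Omega 1 ⟶ Omega q) {u : Fin q → ι ⊕ ι}
    (h : coeff τ 1 u = 0) (z : ι → ℝ) : coeff τ z u = 0 := by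
  -- Scaling reaches from `1` every point without zero coordinates; continuity covers the rest.
  have hd : Dense (Set.univ.pi fun _ : ι => ({0}ᶜ : Set ℝ)) :=
    dense_pi _ fun i _ => dense_compl_singleton 0
  have hc : IsClosed {z : ι → ℝ | coeff τ z u = 0} :=
    isClosed_eq (continuous_coeff τ u) continuous_const
  refine (hc.closure_subset_iff.2 fun a ha => ?_) (hd z)
  have hs := coeff_scale τ a 1 u
  rw [h, mul_zero, one_mul] at hs
  refine (mul_eq_zero.1 hs.symm).resolve_left (Finset.prod_ne_zero_iff.2 fun m _ => ?_)
  rcases u m with i | i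
  · exact one_ne_zero
  · exact ha i trivial

theorem coeff_eq_zero_of_not_injective (τ : Omega 1 ⟶ Omega q) (z : ι → ℝ) {u : Fin q → ι ⊕ ι}
    (hu : ¬ u.Injective) : coeff τ z u = 0 :=
  (univ τ ι (0, z)).toAlternatingMap.map_eq_zero_of_not_injective _ fun h => hu h.of_comp

/-- Scale the `i`-th coordinate by `0`: the factor on the `x`-side is `1` because `x_i` is absent,
and the factor on the `y`-side is `0` because `y_i` is present. -/
theorem coeff_eq_zero_of_inr (τ : Omega 1 ⟶ Omega q) (z : ι → ℝ) {u : Fin q → ι ⊕ ι} {i : ι}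
    (h₁ : Sum.inr i ∈ Set.range u) (h₂ : Sum.inl i ∉ Set.range u) : coeff τ z u = 0 := by
  have hs := coeff_scale τ (Function.update 1 i 0) z u
  rw [Finset.prod_eq_one, one_mul] at hs
  · obtain ⟨m, hm⟩ := h₁
    rw [hs, Finset.prod_eq_zero (Finset.mem_univ m), zero_mul]
    simp [hm]
  · intro m _
    rcases hu : u m with k | k
    · have : k ≠ i := by
        rintro rfl
        exact h₂ ⟨m, hu⟩
      simp [this]
    · rfl

/-- Merge `j` into `i`. Since neither `y_i` nor `y_j` occurs, the `y`-vectors are unaffected, and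
neither is the base point `1`. The coefficient therefore equals one in which `x_i` is repeated. -/
theorem coeff_eq_zero_of_inl (τ : Omega 1 ⟶ Omega q) {u : Fin q → ι ⊕ ι} {i j : ι} (hij : i ≠ j)
    (hi : Sum.inl i ∈ Set.range u) (hj : Sum.inl j ∈ Set.range u)
    (hi' : Sum.inr i ∉ Set.range u) (hj' : Sum.inr j ∉ Set.range u) : coeff τ 1 u = 0 := by
  have h := coeff_map τ (Function.update id j i) 1 u
  refine Eq.trans (Eq.trans ?_ h.symm) ?_
  · refine congrArg (univ τ ι (0, 1)) (funext fun m => ?_)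
    rcases hu : u m with k | k
    · simp [hu, darboux]
    · have h1 : k ≠ i := by
        rintro rfl
        exact hi' ⟨m, hu⟩
      have h2 : k ≠ j := by
        rintro rfl
        exact hj' ⟨m, hu⟩
      have : (Pi.single k 1 : ι → ℝ) ∘ Function.update id j i = Pi.single k 1 := by
        ext l
        by_cases hl : l = j
        · subst hl
          simp [h1.symm, h2.symm]
        · simp [hl]
      simp [hu, darboux, this]
  · obtain ⟨m, hm⟩ := hi
    obtain ⟨n, hn⟩ := hj
    refine coeff_eq_zero_of_not_injective τ 1 fun hinj => hij ?_
    have hmn : m = n := hinj (by simp [hm, hn, hij])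
    rw [hmn, hn] at hm
    exact (Sum.inl_injective hm).symm

theorem coeff_perm (τ : Omega 1 ⟶ Omega q) (z : ι → ℝ) (u : Fin q → ι ⊕ ι)
    (σ : Equiv.Perm (Fin q)) : coeff τ z (u ∘ σ) = Equiv.Perm.sign σ • coeff τ z u :=
  (univ τ ι (0, z)).toAlternatingMap.map_perm (darboux ∘ u) σ

/-- The indices `x₀, y₀, x₁, y₁, …` of the first `q` elements of the standard basis. -/
def stdIndex (q : ℕ) (m : Fin q) : Fin ((q + 1) / 2) ⊕ Fin ((q + 1) / 2) :=
  if (m : ℕ) % 2 = 0 then Sum.inl ⟨m / 2, by omega⟩ else Sum.inr ⟨m / 2, by omega⟩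

theorem inl_mem_range_stdIndex (i : Fin ((q + 1) / 2)) : Sum.inl i ∈ Set.range (stdIndex q) := by
  refine ⟨⟨2 * i, by omega⟩, ?_⟩
  simp [stdIndex]

/-- For odd `q` the last index carries only an `x`, which the bound on `i` excludes. -/
theorem inr_mem_range_stdIndex (i : Fin ((q + 1) / 2)) (hi : 2 * (i : ℕ) + 1 < q) :
    Sum.inr i ∈ Set.range (stdIndex q) := by
  refine ⟨⟨2 * i + 1, hi⟩, ?_⟩
  have h1 : (2 * (i : ℕ) + 1) % 2 = 1 := by omega
  have h2 : (2 * (i : ℕ) + 1) / 2 = i := by omega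
  simp [stdIndex, h1, h2]

/-- Up to the relabelling `e`, the tuple `u` is a reordering of `stdIndex q`, so the two
coefficients differ by a sign. -/
theorem coeff_eq_zero_of_range (τ : Omega 1 ⟶ Omega q) (h : coeff τ 1 (stdIndex q) = 0)
    {u : Fin q → ι ⊕ ι} (hu : u.Injective) (e : ι ≃ Fin ((q + 1) / 2))
    (he : ∀ m, Sum.map e e (u m) ∈ Set.range (stdIndex q)) : coeff τ 1 u = 0 := by
  choose s hs using he
  have hinj : s.Injective := fun m n hmn => hu <| by
    have h1 : Function.Injective (Sum.map e e) := e.injective.sumMap e.injective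
    exact h1 (by rw [← hs, ← hs, hmn])
  let σ : Equiv.Perm (Fin q) := Equiv.ofBijective s (Finite.injective_iff_bijective.1 hinj)
  have h1 : u = Sum.map e.symm e.symm ∘ (stdIndex q ∘ σ) := by
    funext m
    change u m = Sum.map e.symm e.symm (stdIndex q (s m))
    rw [hs, Sum.map_map, e.symm_comp_self, Sum.map_id_id, id]
  rw [h1, coeff_comp_map τ e.symm.injective, coeff_perm]
  change _ • coeff τ 1 _ = _
  rw [h, smul_zero]

theorem coeff_eq_zero_of_surj (τ : Omega 1 ⟶ Omega q) (h : coeff τ 1 (stdIndex q) = 0)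
    {u : Fin q → ι ⊕ ι} (hu : u.Injective) (hl : ∀ i, Sum.inl i ∈ Set.range u)
    (hr : ∀ i j, Sum.inr i ∉ Set.range u → Sum.inr j ∉ Set.range u → i = j) :
    coeff τ 1 u = 0 := by
  by_cases hs : ∀ i, Sum.inr i ∈ Set.range u
  · have hbij : u.Bijective := ⟨hu, by rintro (i | i); exacts [hl i, hs i]⟩
    have hq := Fintype.card_of_bijective hbij
    rw [Fintype.card_fin, Fintype.card_sum] at hq
    refine coeff_eq_zero_of_range τ h hu (Fintype.equivFinOfCardEq (by omega)) fun m => ?_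
    rcases u m with i | i
    · exact inl_mem_range_stdIndex _
    · exact inr_mem_range_stdIndex _ (by omega)
  · push Not at hs
    obtain ⟨i₀, hi₀⟩ := hs
    -- Adding the one missing `y` makes `u` a bijection, whence `q + 1 = 2 * card ι`.
    let u' : Option (Fin q) → ι ⊕ ι := fun o => o.elim (Sum.inr i₀) u
    have hbij : u'.Bijective := by
      refine ⟨?_, ?_⟩
      · rintro (_ | m) (_ | n) hmn
        · rfl
        · exact (hi₀ ⟨n, hmn.symm⟩).elim
        · exact (hi₀ ⟨m, hmn⟩).elim
        · exact congrArg some (hu hmn)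
      · rintro (i | i)
        · obtain ⟨m, hm⟩ := hl i
          exact ⟨some m, hm⟩
        · by_cases hi : Sum.inr i ∈ Set.range u
          · obtain ⟨m, hm⟩ := hi
            exact ⟨some m, hm⟩
          · exact ⟨none, congrArg Sum.inr (hr _ _ hi₀ hi)⟩
    have hq := Fintype.card_of_bijective hbij
    rw [Fintype.card_option, Fintype.card_fin, Fintype.card_sum] at hq
    have hpos : 0 < (q + 1) / 2 := by
      have := Fintype.card_pos_iff.2 ⟨i₀⟩
      omega
    let e₀ : ι ≃ Fin ((q + 1) / 2) := Fintype.equivFinOfCardEq (by omega)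
    let last : Fin ((q + 1) / 2) := ⟨(q + 1) / 2 - 1, by omega⟩
    -- The swap puts the unpaired index in the last place, where `stdIndex` has no `y`.
    let e : ι ≃ Fin ((q + 1) / 2) := e₀.trans (Equiv.swap (e₀ i₀) last)
    have hlast : e i₀ = last := Equiv.swap_apply_left _ _
    refine coeff_eq_zero_of_range τ h hu e fun m => ?_
    rcases hm : u m with i | i
    · exact inl_mem_range_stdIndex _
    · refine inr_mem_range_stdIndex _ ?_
      have h1 : e i ≠ last := by
        rw [← hlast]
        intro hi
        rw [e.injective hi] at hm
        exact hi₀ ⟨m, hm⟩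
      have h2 : (e i : ℕ) ≠ (q + 1) / 2 - 1 := fun hi => h1 (Fin.ext hi)
      omega

theorem coeff_eq_zero (τ : Omega 1 ⟶ Omega q) (h : coeff τ 1 (stdIndex q) = 0)
    (z : ι → ℝ) (u : Fin q → ι ⊕ ι) : coeff τ z u = 0 := by
  refine coeff_eq_zero_of_one τ ?_ z
  by_cases hu : u.Injective
  swap
  · exact coeff_eq_zero_of_not_injective τ 1 hu
  by_cases h₁ : ∃ i, Sum.inr i ∈ Set.range u ∧ Sum.inl i ∉ Set.range u
  · obtain ⟨i, hi, hi'⟩ := h₁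
    exact coeff_eq_zero_of_inr τ 1 hi hi'
  by_cases h₂ : ∃ i j, i ≠ j ∧ Sum.inl i ∈ Set.range u ∧ Sum.inl j ∈ Set.range u ∧
      Sum.inr i ∉ Set.range u ∧ Sum.inr j ∉ Set.range u
  · obtain ⟨i, j, hij, hi, hj, hi', hj'⟩ := h₂
    exact coeff_eq_zero_of_inl τ hij hi hj hi' hj'
  push Not at h₁ h₂
  classical
  -- By `h₁` every `y_i` that occurs comes with `x_i`, so `u` takes values in these coordinates and
  -- the others can be dropped.
  let κ := {i : ι // Sum.inl i ∈ Set.range u}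
  have hex : ∀ m, ∃ s : κ ⊕ κ, Sum.map Subtype.val Subtype.val s = u m := by
    intro m
    rcases hm : u m with i | i
    · exact ⟨Sum.inl ⟨i, m, hm⟩, rfl⟩
    · exact ⟨Sum.inr ⟨i, h₁ i ⟨m, hm⟩⟩, rfl⟩
  choose u' hu' using hex
  have huu : u = Sum.map Subtype.val Subtype.val ∘ u' := funext fun m => (hu' m).symm
  have hval : Function.Injective (Sum.map (Subtype.val : κ → ι) (Subtype.val : κ → ι)) :=
    Subtype.val_injective.sumMap Subtype.val_injective
  have hmem : ∀ s : κ ⊕ κ, Sum.map Subtype.val Subtype.val s ∈ Set.range u → s ∈ Set.range u' := by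
    rintro s ⟨m, hm⟩
    exact ⟨m, hval ((hu' m).trans hm)⟩
  have hmem' : ∀ s : κ ⊕ κ, s ∈ Set.range u' → Sum.map Subtype.val Subtype.val s ∈ Set.range u := by
    rintro s ⟨m, rfl⟩
    exact ⟨m, (hu' m).symm⟩
  rw [huu, coeff_comp_map τ Subtype.val_injective]
  refine coeff_eq_zero_of_surj τ h (fun m n hmn => hu ?_) (fun i => hmem _ i.2) fun i j hi hj => ?_
  · rw [← hu', ← hu', hmn]
  · by_contra hij
    exact hj (hmem _ (h₂ i j (fun h => hij (Subtype.ext h)) i.2 j.2 fun h => hi (hmem _ h)))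

/-- The coefficient that determines a form on `Ω^1`, as a linear functional. -/
def stdCoeff (q : ℕ) : (Omega 1 ⟶ Omega q) →ₗ[ℝ] ℝ where
  toFun τ := coeff τ 1 (stdIndex q)
  map_add' _ _ := rfl
  map_smul' _ _ := rfl

theorem stdCoeff_injective (q : ℕ) : Function.Injective (stdCoeff q) :=
  (injective_iff_map_eq_zero _).2 fun τ h =>
    eq_zero_of_coeff τ fun _ z u => coeff_eq_zero τ h z u

theorem span_singleton_eq_top {τ : Omega 1 ⟶ Omega q} (hτ : τ ≠ 0) :
    Submodule.span ℝ {τ} = ⊤ := by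
  have h0 : stdCoeff q τ ≠ 0 := fun h => hτ (stdCoeff_injective q (h.trans (map_zero _).symm))
  refine eq_top_iff.2 fun σ _ => Submodule.mem_span_singleton.2
    ⟨stdCoeff q σ / stdCoeff q τ, stdCoeff_injective q ?_⟩
  rw [map_smul, smul_eq_mul, div_mul_cancel₀ _ h0]

end Omega

end Liouville

/-! ### Alternating sums over permutations -/

section AltSum

variable {E : Type*} {p q n : ℕ}

/-- The alternating sum of a function of `n` vectors over all permutations of its arguments. -/
def altSum (F : (Fin n → E) → ℝ) (v : Fin n → E) : ℝ :=
  ∑ σ : Equiv.Perm (Fin n), ((Equiv.Perm.sign σ : ℤ) : ℝ) * F (v ∘ σ)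

theorem altSum_mul_right (F : (Fin n → E) → ℝ) (v : Fin n → E) (ρ : Equiv.Perm (Fin n)) :
    ∑ σ : Equiv.Perm (Fin n), ((Equiv.Perm.sign σ : ℤ) : ℝ) *
      (((Equiv.Perm.sign ρ : ℤ) : ℝ) * F (v ∘ σ ∘ ρ)) = altSum F v := by
  refine Eq.trans (Finset.sum_congr rfl fun σ _ => ?_) (Equiv.sum_comp (Equiv.mulRight ρ)
    fun σ => ((Equiv.Perm.sign σ : ℤ) : ℝ) * F (v ∘ σ))
  rw [Equiv.coe_mulRight, Equiv.Perm.sign_mul]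
  push_cast
  rw [mul_assoc]

/-- The permutation of `Fin (p + q)` acting blockwise. -/
def blockPerm (ρ : Equiv.Perm (Fin p)) (π : Equiv.Perm (Fin q)) : Equiv.Perm (Fin (p + q)) :=
  finSumFinEquiv.permCongr (Equiv.sumCongr ρ π)

theorem sign_blockPerm (ρ : Equiv.Perm (Fin p)) (π : Equiv.Perm (Fin q)) :
    Equiv.Perm.sign (blockPerm ρ π) = Equiv.Perm.sign ρ * Equiv.Perm.sign π := by
  rw [blockPerm, Equiv.Perm.sign_permCongr]
  exact Equiv.Perm.sign_sumCongr ρ π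

theorem blockPerm_castAdd (ρ : Equiv.Perm (Fin p)) (π : Equiv.Perm (Fin q)) (i : Fin p) :
    blockPerm ρ π (Fin.castAdd q i) = Fin.castAdd q (ρ i) := by
  simp [blockPerm, Equiv.permCongr_apply]

theorem blockPerm_natAdd (ρ : Equiv.Perm (Fin p)) (π : Equiv.Perm (Fin q)) (i : Fin q) :
    blockPerm ρ π (Fin.natAdd p i) = Fin.natAdd p (π i) := by
  simp [blockPerm, Equiv.permCongr_apply]

/-- Expanding both factors gives one term for each of the `p! q!` block permutations. Each yields
the same total after reindexing, which cancels the normalization of `wedgeAt`. -/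
theorem wedgeAt_altSum [NormedAddCommGroup E] [NormedSpace ℝ E] {α : E [⋀^Fin p]→L[ℝ] ℝ}
    {β : E [⋀^Fin q]→L[ℝ] ℝ} {S : (Fin p → E) → ℝ} {T : (Fin q → E) → ℝ}
    (hS : ∀ v, α v = altSum S v) (hT : ∀ v, β v = altSum T v) (v : Fin (p + q) → E) :
    wedgeAt α β v =
      altSum (fun w => S (fun i => w (Fin.castAdd q i)) * T (fun i => w (Fin.natAdd p i))) v := by
  rw [wedgeAt_apply]
  set F : (Fin (p + q) → E) → ℝ :=
    fun w => S (fun i => w (Fin.castAdd q i)) * T (fun i => w (Fin.natAdd p i)) with hF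
  have h1 : ∀ σ : Equiv.Perm (Fin (p + q)),
      α (fun i => v (σ (Fin.castAdd q i))) * β (fun i => v (σ (Fin.natAdd p i))) =
        ∑ x : Equiv.Perm (Fin p) × Equiv.Perm (Fin q),
          ((Equiv.Perm.sign (blockPerm x.1 x.2) : ℤ) : ℝ) * F (v ∘ σ ∘ blockPerm x.1 x.2) := by
    intro σ
    rw [hS, hT, altSum, altSum, Finset.sum_mul_sum, ← Finset.univ_product_univ,
      Finset.sum_product]
    refine Finset.sum_congr rfl fun ρ _ => Finset.sum_congr rfl fun π _ => ?_
    rw [sign_blockPerm, hF]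
    simp only [Function.comp_def, blockPerm_castAdd, blockPerm_natAdd]
    push_cast
    ring
  simp only [h1, Finset.mul_sum]
  rw [Finset.sum_comm]
  simp only [← Finset.mul_sum]
  rw [Finset.sum_congr rfl fun x _ => altSum_mul_right F v (blockPerm x.1 x.2), Finset.sum_const,
    Finset.card_univ, Fintype.card_prod, Fintype.card_perm, Fintype.card_perm, Fintype.card_fin,
    Fintype.card_fin, nsmul_eq_mul]
  push_cast
  rw [← mul_assoc, inv_mul_cancel₀, one_mul]
  positivity

/-- The permutation of `Fin (n + 1)` sending `0` to `i` and acting as `σ` on the others. -/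
def insertPerm (i : Fin (n + 1)) (σ : Equiv.Perm (Fin n)) : Equiv.Perm (Fin (n + 1)) :=
  i.cycleRange.symm * Equiv.Perm.decomposeFin.symm (0, σ)

theorem insertPerm_zero (i : Fin (n + 1)) (σ : Equiv.Perm (Fin n)) : insertPerm i σ 0 = i := by
  rw [insertPerm, Equiv.Perm.mul_apply, Equiv.Perm.decomposeFin_symm_apply_zero,
    Fin.cycleRange_symm_zero]

theorem insertPerm_succ (i : Fin (n + 1)) (σ : Equiv.Perm (Fin n)) (j : Fin n) :
    insertPerm i σ j.succ = i.succAbove (σ j) := by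
  rw [insertPerm, Equiv.Perm.mul_apply, Equiv.Perm.decomposeFin_symm_apply_succ, Equiv.swap_self,
    Equiv.refl_apply, Fin.cycleRange_symm_succ]

theorem sign_insertPerm (i : Fin (n + 1)) (σ : Equiv.Perm (Fin n)) :
    Equiv.Perm.sign (insertPerm i σ) = (-1) ^ (i : ℕ) * Equiv.Perm.sign σ := by
  rw [insertPerm, Equiv.Perm.sign_mul, Equiv.Perm.decomposeFin.symm_sign, if_pos rfl, one_mul,
    Equiv.Perm.sign_symm, Fin.sign_cycleRange]

theorem insertPerm_bijective : Function.Bijective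
    fun x : Fin (n + 1) × Equiv.Perm (Fin n) => insertPerm x.1 x.2 := by
  rw [Fintype.bijective_iff_injective_and_card]
  constructor
  · rintro ⟨i, σ⟩ ⟨j, τ⟩ h
    have h0 : i = j := by
      have := DFunLike.congr_fun h 0
      simpa only [insertPerm_zero] using this
    subst h0
    refine Prod.ext rfl (Equiv.ext fun k => ?_)
    have := DFunLike.congr_fun h k.succ
    simpa only [insertPerm_succ, Fin.succAbove_right_inj] using this
  · rw [Fintype.card_prod, Fintype.card_perm, Fintype.card_perm, Fintype.card_fin,
      Fintype.card_fin, Nat.factorial_succ]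

/-- Permutations are sorted by the image `i` of `0`, with sign `(-1)^i` times that of the rest. The
left side has the shape of the exterior derivative of a form linear in the base point. -/
theorem sum_altSum_removeNth (F : E → (Fin n → E) → ℝ) (v : Fin (n + 1) → E) :
    ∑ i : Fin (n + 1), (-1 : ℝ) ^ (i : ℕ) * altSum (F (v i)) (i.removeNth v) =
      altSum (fun w => F (w 0) (fun j => w j.succ)) v := by
  rw [altSum, ← insertPerm_bijective.sum_comp, ← Finset.univ_product_univ, Finset.sum_product]
  refine Finset.sum_congr rfl fun i _ => ?_
  rw [altSum, Finset.mul_sum]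
  refine Finset.sum_congr rfl fun σ _ => ?_
  rw [sign_insertPerm]
  simp only [Function.comp_apply, insertPerm_zero, insertPerm_succ, Function.comp_def,
    Fin.removeNth]
  push_cast
  ring

/-- The product `∏ M (v_{2i}) (v_{2i+1})`. -/
def pairProd (M : E → E → ℝ) (k : ℕ) (v : Fin (2 * k) → E) : ℝ :=
  ∏ i : Fin k, M (v ⟨2 * i, by omega⟩) (v ⟨2 * i + 1, by omega⟩)

theorem pairProd_succ (M : E → E → ℝ) (k : ℕ) (v : Fin (2 * k + 2) → E) :
    pairProd M (k + 1) v = pairProd M k (fun i => v (Fin.castAdd 2 i)) *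
      M (v (Fin.natAdd (2 * k) 0)) (v (Fin.natAdd (2 * k) 1)) := by
  rw [pairProd, Fin.prod_univ_castSucc]
  rfl

theorem pairProd_succ' (M : E → E → ℝ) (k : ℕ) (v : Fin (2 * (k + 1)) → E) :
    pairProd M (k + 1) v = M (v ⟨0, by omega⟩) (v ⟨1, by omega⟩) *
      pairProd M k (fun i => v ⟨i + 2, by omega⟩) := by
  rw [pairProd, Fin.prod_univ_succ]
  rfl

theorem altSum_fin_one (F : (Fin 1 → E) → ℝ) (v : Fin 1 → E) : altSum F v = F v := by
  simp [altSum]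

theorem altSum_fin_zero (F : (Fin 0 → E) → ℝ) (v : Fin 0 → E) : altSum F v = F v := by
  simp [altSum, Subsingleton.elim (v ∘ _) v]

theorem altSum_cast {m n : ℕ} (h : m = n) (F : (Fin n → E) → ℝ) (v : Fin n → E) :
    altSum F v = altSum (fun w : Fin m → E => F (w ∘ Fin.cast h.symm)) (v ∘ Fin.cast h) := by
  subst h
  rfl

/-- A permutation of `Fin (2 * k)` that maps pairs `(2i, 2i+1)` to such pairs is even. -/
theorem sign_eq_one_of_pairs {k : ℕ} (σ : Equiv.Perm (Fin (2 * k))) (π : Fin k → Fin k)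
    (h₀ : ∀ i : Fin k, (σ ⟨2 * i, by omega⟩ : ℕ) = 2 * π i)
    (h₁ : ∀ i : Fin k, (σ ⟨2 * i + 1, by omega⟩ : ℕ) = 2 * π i + 1) :
    Equiv.Perm.sign σ = 1 := by
  -- In these coordinates `σ` is two copies of `π`, so its sign is a square.
  let e : Fin 2 × Fin k ≃ Fin (2 * k) :=
    (Equiv.prodComm _ _).trans (finProdFinEquiv.trans (finCongr (mul_comm k 2)))
  have he : ∀ x, (e x : ℕ) = x.1 + 2 * x.2 := fun x => rfl
  have hπ : π.Injective := fun i j hij => by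
    have h : σ ⟨2 * i, by omega⟩ = σ ⟨2 * j, by omega⟩ := Fin.ext (by rw [h₀, h₀, hij])
    have := congrArg Fin.val (σ.injective h)
    exact Fin.ext (by simpa using this)
  let ρ : Equiv.Perm (Fin k) := Equiv.ofBijective π (Finite.injective_iff_bijective.1 hπ)
  have hσ : σ = e.permCongr (Equiv.prodCongrRight fun _ : Fin 2 => ρ) := by
    refine Equiv.ext fun m => ?_
    obtain ⟨⟨b, i⟩, rfl⟩ := e.surjective m
    rw [Equiv.permCongr_apply, Equiv.symm_apply_apply]
    refine Fin.ext ?_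
    rw [he]
    fin_cases b
    · have : e (0, i) = ⟨2 * i, by omega⟩ := Fin.ext (by simp [he])
      change (σ (e (0, i)) : ℕ) = 0 + 2 * (π i : ℕ)
      rw [this, h₀, zero_add]
    · have : e (1, i) = ⟨2 * i + 1, by omega⟩ := Fin.ext (by simp [he, add_comm])
      change (σ (e (1, i)) : ℕ) = 1 + 2 * (π i : ℕ)
      rw [this, h₁, add_comm]
  rw [hσ, Equiv.Perm.sign_permCongr, Equiv.Perm.sign_prodCongrRight, Fin.prod_univ_two,
    Int.units_mul_self]

/-- A term vanishes unless its permutation carries each pair `(2i, 2i+1)` to such a pair in order.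
Those permutations are even, so no term is negative, and the identity contributes `1`. -/
theorem altSum_pairProd_pos {M : E → E → ℝ} {k : ℕ} {v : Fin (2 * k) → E}
    (hM : ∀ m n : Fin (2 * k), M (v m) (v n) =
      if (m : ℕ) % 2 = 0 ∧ (n : ℕ) = m + 1 then 1 else 0) :
    0 < altSum (pairProd M k) v := by
  have hterm : ∀ σ : Equiv.Perm (Fin (2 * k)),
      0 ≤ ((Equiv.Perm.sign σ : ℤ) : ℝ) * pairProd M k (v ∘ σ) := by
    intro σ
    by_cases h : ∀ i : Fin k, (σ ⟨2 * i, by omega⟩ : ℕ) % 2 = 0 ∧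
        (σ ⟨2 * i + 1, by omega⟩ : ℕ) = σ ⟨2 * i, by omega⟩ + 1
    · rw [sign_eq_one_of_pairs σ (fun i => ⟨(σ ⟨2 * i, by omega⟩ : ℕ) / 2, by omega⟩)
        (fun i => by have := (h i).1; dsimp only; omega)
        (fun i => by have := h i; dsimp only; omega)]
      rw [Units.val_one, Int.cast_one, one_mul]
      refine Finset.prod_nonneg fun i _ => ?_
      rw [Function.comp_apply, Function.comp_apply, hM]
      split_ifs <;> norm_num
    · push Not at h
      obtain ⟨i, hi⟩ := h
      rw [pairProd, Finset.prod_eq_zero (Finset.mem_univ i), mul_zero]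
      rw [Function.comp_apply, Function.comp_apply, hM, if_neg]
      exact fun h => hi h.1 h.2
  refine Finset.sum_pos' (fun σ _ => hterm σ) ⟨1, Finset.mem_univ _, ?_⟩
  rw [Equiv.Perm.sign_one, Units.val_one, Int.cast_one, one_mul]
  refine Finset.prod_pos fun i _ => ?_
  change 0 < M (v _) (v _)
  rw [hM, if_pos ⟨by simp, rfl⟩]
  exact one_pos

end AltSum

/-! ### The forms `(dω)^k` and `ω ∧ (dω)^k`: values, differentials, nonvanishing -/

namespace Omega

/-- The form `(dω)^k` on `Ω^1`. -/
abbrev evenGen (k : ℕ) : Omega 1 ⟶ Omega (2 * k) :=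
  wedgePow (dLinear (Omega 1) 1 (taut 1)) k

/-- The form `ω ∧ (dω)^k` on `Ω^1`. -/
abbrev oddGen (k : ℕ) : Omega 1 ⟶ Omega (1 + 2 * k) := wedge (taut 1) (evenGen k)

variable {ι : Type} [Fintype ι]

theorem univ_taut (p : (ι → ℝ) × (ι → ℝ)) : univ (taut 1) ι p = liouville ι p :=
  congrFun (plotEval_taut _ _) p

theorem fderiv_liouville (p : (ι → ℝ) × (ι → ℝ)) : fderiv ℝ (liouville ι) p = liouvilleCLM ι :=
  (liouvilleCLM ι).fderiv

theorem univ_dLinear {q : ℕ} (τ : Omega 1 ⟶ Omega q) (p : (ι → ℝ) × (ι → ℝ)) :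
    univ (dLinear (Omega 1) q τ) ι p = extDeriv (univ τ ι) p :=
  plotEval_dLinear τ _ _ p

theorem univ_d_taut (p : (ι → ℝ) × (ι → ℝ)) (v : Fin 2 → (ι → ℝ) × (ι → ℝ)) :
    univ (dLinear (Omega 1) 1 (taut 1)) ι p v =
      altSum (fun w => liouvillePairing ι (w 0) (w 1)) v := by
  rw [univ_dLinear, funext univ_taut, extDeriv, fderiv_liouville,
    ContinuousAlternatingMap.alternatizeUncurryFin_apply]
  have h := sum_altSum_removeNth (fun (a : (ι → ℝ) × (ι → ℝ)) (w : Fin 1 → (ι → ℝ) × (ι → ℝ)) =>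
    liouvillePairing ι a (w 0)) v
  refine Eq.trans (Finset.sum_congr rfl fun i _ => ?_) h
  rw [altSum_fin_one, zsmul_eq_mul]
  push_cast
  rfl

/-- The right side does not involve `p`: on Liouville forms `(dω)^k` has constant coefficients. -/
theorem univ_evenGen (k : ℕ) (p : (ι → ℝ) × (ι → ℝ)) (v : Fin (2 * k) → (ι → ℝ) × (ι → ℝ)) :
    univ (evenGen k) ι p v = altSum (pairProd (fun a b => liouvillePairing ι a b) k) v := by
  induction k with
  | zero =>
    rw [altSum_fin_zero]
    rfl
  | succ k ih =>
    refine (DFunLike.congr_fun (plotEval_wedge (evenGen k) (dLinear (Omega 1) 1 (taut 1))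
      (liouville ι) (contDiff_liouville ι) p) v).trans ?_
    exact (wedgeAt_altSum ih (univ_d_taut p) v).trans
      (congrArg (altSum · v) (funext fun w => (pairProd_succ _ k w).symm))

theorem univ_oddGen_eq (k : ℕ) (p : (ι → ℝ) × (ι → ℝ)) :
    univ (oddGen k) ι p = wedgeAt (liouville ι p) (univ (evenGen k) ι p) :=
  (plotEval_wedge _ _ _ _ p).trans (congrArg (wedgeAt · _) (univ_taut p))

theorem univ_d_oddGen (k : ℕ) (p : (ι → ℝ) × (ι → ℝ))
    (v : Fin (1 + 2 * k + 1) → (ι → ℝ) × (ι → ℝ)) :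
    univ (dLinear (Omega 1) _ (oddGen k)) ι p v =
      univ (evenGen (k + 1)) ι p (v ∘ Fin.cast (by ring)) := by
  have hconst : ∀ p, univ (evenGen k) ι p = univ (evenGen k) ι 0 := fun p => by
    ext w
    rw [univ_evenGen, univ_evenGen]
  -- With `(dω)^k` constant, `ω ∧ (dω)^k` is linear in the base point. Its derivative is `L` itself,
  -- and its exterior derivative is the alternating sum of `L`; no Leibniz rule enters.
  let L : ((ι → ℝ) × (ι → ℝ)) →L[ℝ] ((ι → ℝ) × (ι → ℝ)) [⋀^Fin (1 + 2 * k)]→L[ℝ] ℝ :=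
    (LinearMap.toContinuousLinearMap (wedgeBilin.flip (univ (evenGen k) ι 0))).comp
      (liouvilleCLM ι)
  have hL : univ (oddGen k) ι = L := funext fun p => by
    rw [univ_oddGen_eq, hconst]
    rfl
  rw [univ_dLinear, hL, extDeriv, ContinuousLinearMap.fderiv,
    ContinuousAlternatingMap.alternatizeUncurryFin_apply]
  have hLv : ∀ a w, L a w = altSum (fun w : Fin (1 + 2 * k) → (ι → ℝ) × (ι → ℝ) =>
      liouvillePairing ι a (w (Fin.castAdd (2 * k) 0)) *
        pairProd (fun a b => liouvillePairing ι a b) k fun i => w (Fin.natAdd 1 i)) w :=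
    fun a w => wedgeAt_altSum (α := liouville ι a)
      (S := fun w => liouvillePairing ι a (w 0)) (fun w => (altSum_fin_one _ w).symm)
      (univ_evenGen k 0) w
  simp only [hLv, zsmul_eq_mul]
  push_cast
  rw [sum_altSum_removeNth (fun a w => liouvillePairing ι a (w (Fin.castAdd (2 * k) 0)) *
        pairProd (fun a b => liouvillePairing ι a b) k fun i => w (Fin.natAdd 1 i)),
    univ_evenGen, altSum_cast (show 2 * (k + 1) = 1 + 2 * k + 1 by ring)]
  refine congrArg (altSum · _) (funext fun w => ?_)
  rw [pairProd_succ']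
  refine congrArg₂ _ rfl (congrArg _ (funext fun i => congrArg w (Fin.ext ?_)))
  simp

theorem evenGen_ne_zero (k : ℕ) : evenGen k ≠ 0 := by
  intro h
  -- The vectors are ordered `y_0, x_0, y_1, x_1, …`, since the pairing reads the `y`-part of its
  -- first argument and the `x`-part of its second.
  let v : Fin (2 * k) → (Fin k → ℝ) × (Fin k → ℝ) := fun m =>
    if (m : ℕ) % 2 = 0 then darboux (Sum.inr ⟨m / 2, by omega⟩)
    else darboux (Sum.inl ⟨m / 2, by omega⟩)
  have hpos : 0 < altSum (pairProd (fun a b => liouvillePairing (Fin k) a b) k) v := by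
    refine altSum_pairProd_pos fun m n => ?_
    rw [liouvillePairing_apply]
    rcases Nat.mod_two_eq_zero_or_one m with hm | hm <;>
      rcases Nat.mod_two_eq_zero_or_one n with hn | hn <;>
      simp [v, hm, hn, darboux, Pi.single_apply] <;> grind
  rw [← univ_evenGen k 0, h] at hpos
  exact lt_irrefl 0 hpos

/-- The equality of forms of propositionally equal degrees may be checked on Liouville forms. -/
theorem eq_cast_of_univ {m n : ℕ} (h : m = n) {σ : Omega 1 ⟶ Omega m} {τ : Omega 1 ⟶ Omega n}
    (H : ∀ l (p : (Fin l → ℝ) × (Fin l → ℝ)) v,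
      univ τ (Fin l) p v = univ σ (Fin l) p (v ∘ Fin.cast h)) : τ = h ▸ σ := by
  subst h
  refine sub_eq_zero.1 (eq_zero_of_univ _ fun l p => ContinuousAlternatingMap.ext fun v => ?_)
  exact sub_eq_zero.2 (H l p v)

theorem d_oddGen (k : ℕ) : dLinear (Omega 1) (1 + 2 * k) (oddGen k) =
    (show 2 * (k + 1) = 1 + 2 * k + 1 by ring) ▸ evenGen (k + 1) :=
  eq_cast_of_univ _ fun _ p v => univ_d_oddGen k p v

/-- Its differential `(dω)^(k+1)` is already known to be nonzero. -/
theorem oddGen_ne_zero (k : ℕ) : oddGen k ≠ 0 := by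
  intro h
  have h1 := d_oddGen k
  rw [h, map_zero] at h1
  have h2 : ∀ {m n : ℕ} (e : m = n) (σ : Omega 1 ⟶ Omega m), 0 = e ▸ σ → σ = 0 := by
    rintro m _ rfl σ h
    exact h.symm
  exact evenGen_ne_zero _ (h2 _ _ h1)

theorem d_evenGen (k : ℕ) : dLinear (Omega 1) (2 * k) (evenGen k) = 0 := by
  refine eq_zero_of_univ _ fun l p => ?_
  have hconst : univ (evenGen k) (Fin l) = fun _ => univ (evenGen k) (Fin l) 0 := funext fun p => by
    ext w
    rw [univ_evenGen, univ_evenGen]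
  rw [univ_dLinear, hconst, extDeriv, fderiv_fun_const]
  ext v
  simp [ContinuousAlternatingMap.alternatizeUncurryFin_apply]

end Omega

/-! ### Coordinates with respect to the generators -/

namespace Omega

/-- Combines the two parity families into one indexed by `q`, confining the degree casts to this
statement. -/
theorem exists_gen (q : ℕ) : ∃ g : Omega 1 ⟶ Omega q, g ≠ 0 ∧
    (∀ (k : ℕ) (h : 2 * k = q), g = h ▸ evenGen k) ∧
    (∀ (k : ℕ) (h : 1 + 2 * k = q), g = h ▸ oddGen k) := by
  obtain ⟨k, hk | hk⟩ := Nat.even_or_odd' q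
  · subst hk
    refine ⟨evenGen k, evenGen_ne_zero k, fun l hl => ?_, fun l hl => by omega⟩
    obtain rfl : l = k := by omega
    rfl
  · obtain rfl : 1 + 2 * k = q := by omega
    refine ⟨oddGen k, oddGen_ne_zero k, fun l hl => by omega, fun l hl => ?_⟩
    obtain rfl : l = k := by omega
    rfl

/-- The generator of `Ω^q(Ω^1)`: `(dω)^k` if `q = 2k`, and `ω ∧ (dω)^k` if `q = 1 + 2k`. -/
def gen (q : ℕ) : Omega 1 ⟶ Omega q := (exists_gen q).choose

theorem gen_ne_zero (q : ℕ) : gen q ≠ 0 := (exists_gen q).choose_spec.1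

theorem gen_even (k : ℕ) : gen (2 * k) = evenGen k := (exists_gen (2 * k)).choose_spec.2.1 k rfl

theorem gen_odd (k : ℕ) : gen (1 + 2 * k) = oddGen k :=
  (exists_gen (1 + 2 * k)).choose_spec.2.2 k rfl

theorem d_gen (q : ℕ) :
    dLinear (Omega 1) q (gen q) = if Odd q then gen (q + 1) else 0 := by
  obtain ⟨k, hk | hk⟩ := Nat.even_or_odd' q
  · subst hk
    rw [gen_even, d_evenGen, if_neg (by simp)]
  · obtain rfl : 1 + 2 * k = q := by omega
    rw [gen_odd, d_oddGen, if_pos ⟨k, by ring⟩]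
    exact ((exists_gen (1 + 2 * k + 1)).choose_spec.2.1 (k + 1) (by ring)).symm

theorem stdCoeff_gen_ne_zero (q : ℕ) : stdCoeff q (gen q) ≠ 0 := fun h =>
  gen_ne_zero q (stdCoeff_injective q (h.trans (map_zero _).symm))

theorem smul_stdCoeff_bijective (q : ℕ) :
    Function.Bijective ((stdCoeff q (gen q))⁻¹ • stdCoeff q) := by
  have h := stdCoeff_gen_ne_zero q
  refine ⟨fun σ τ hστ => stdCoeff_injective q ?_, fun c => ⟨c • gen q, ?_⟩⟩
  · exact mul_left_cancel₀ (inv_ne_zero h) hστ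
  · rw [map_smul, LinearMap.smul_apply, smul_eq_mul, smul_eq_mul, inv_mul_cancel₀ h, mul_one]

/-- The coordinate of a `q`-form on `Ω^1` with respect to the generator. -/
def genEquiv (q : ℕ) : (Omega 1 ⟶ Omega q) ≃ₗ[ℝ] ULift.{1} ℝ :=
  (LinearEquiv.ofBijective _ (smul_stdCoeff_bijective q)).trans ULift.moduleEquiv.symm

theorem genEquiv_gen (q : ℕ) : genEquiv q (gen q) = ULift.up 1 :=
  congrArg ULift.up (inv_mul_cancel₀ (stdCoeff_gen_ne_zero q))

theorem exists_smul_gen {q : ℕ} (τ : Omega 1 ⟶ Omega q) : ∃ c : ℝ, c • gen q = τ :=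
  Submodule.mem_span_singleton.1
    (span_singleton_eq_top (gen_ne_zero q) ▸ Submodule.mem_top (x := τ))

theorem genEquiv_d (q : ℕ) (τ : Omega 1 ⟶ Omega q) :
    genEquiv (q + 1) (dLinear (Omega 1) q τ) = if Odd q then genEquiv q τ else 0 := by
  obtain ⟨c, rfl⟩ := exists_smul_gen τ
  rw [map_smul, map_smul, map_smul, d_gen, genEquiv_gen]
  split_ifs
  · rw [genEquiv_gen]
  · rw [map_zero, smul_zero]

end Omega

/-! ### The isomorphism of complexes and the cohomology -/

theorem deRhamComplex_d (F : Manᵒᵖ ⥤ Type) (q : ℕ) :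
    (deRhamComplex F).d q (q + 1) = ModuleCat.ofHom (Omega.dLinear F q) :=
  CochainComplex.of_d (fun q => ModuleCat.of ℝ (F ⟶ Omega q))
    (fun q => ModuleCat.ofHom (Omega.dLinear F q)) q

theorem alternatingComplex_d (q : ℕ) :
    alternatingComplex.d q (q + 1) = if Odd q then 𝟙 (ModuleCat.of ℝ (ULift.{1} ℝ)) else 0 :=
  CochainComplex.of_d (fun _ => ModuleCat.of ℝ (ULift.{1} ℝ))
    (fun q => if Odd q then 𝟙 _ else 0) q

/-- The de Rham complex of `Ω^1` is the alternating complex, via the coordinates with respect to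
the generators. -/
def deRhamIso : deRhamComplex (Omega 1) ≅ alternatingComplex :=
  HomologicalComplex.Hom.isoOfComponents
    (fun q => (Omega.genEquiv q).toModuleIso) (by
      rintro q _ rfl
      refine Eq.trans (congrArg _ (alternatingComplex_d q)) <|
        Eq.trans ?_ (congrArg (· ≫ (Omega.genEquiv (q + 1)).toModuleIso.hom) (deRhamComplex_d _ q).symm)
      refine ModuleCat.hom_ext (LinearMap.ext fun τ => ?_)
      refine Eq.trans ?_ (Omega.genEquiv_d q τ).symm
      split_ifs <;> rfl)

theorem deRhamIso_gen (q : ℕ) : (deRhamIso.hom.f q).hom (Omega.gen q) = ULift.up 1 :=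
  Omega.genEquiv_gen q

/-- In a positive degree exactly one of the two adjacent differentials is the identity: the incoming
one if `q` is odd, the outgoing one if `q` is even. -/
theorem alternatingComplex_exactAt (q : ℕ) : alternatingComplex.ExactAt (q + 1) := by
  rw [HomologicalComplex.exactAt_iff' _ q (q + 1) (q + 1 + 1) (by simp) (by simp),
    ShortComplex.moduleCat_exact_iff]
  intro x hx
  change (alternatingComplex.d (q + 1) (q + 1 + 1)).hom x = 0 at hx
  change ∃ y, (alternatingComplex.d q (q + 1)).hom y = x
  rw [alternatingComplex_d] at hx ⊢
  by_cases hq : Odd q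
  · rw [if_pos hq]
    exact ⟨x, rfl⟩
  · rw [if_pos (Nat.not_odd_iff_even.1 hq).add_one] at hx
    exact ⟨0, (map_zero _).trans hx.symm⟩

theorem alternatingComplex_homology_zero :
    Nonempty (alternatingComplex.homology 0 ≅ ModuleCat.of ℝ (ULift.{1} ℝ)) := by
  -- Degree `0` has no predecessor, so `prev 0` takes its default value `0`, and the differential
  -- from `0` to `0` vanishes by `shape`.
  have hf : (alternatingComplex.sc 0).f = 0 :=
    alternatingComplex.shape ((ComplexShape.up ℕ).prev 0) 0 (by simp)
  have hg : (alternatingComplex.sc 0).g = 0 := by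
    change alternatingComplex.d 0 ((ComplexShape.up ℕ).next 0) = 0
    rw [CochainComplex.next, alternatingComplex_d, if_neg (by decide)]
    rfl
  exact ⟨(ShortComplex.HomologyData.ofZeros _ hf hg).left.homologyIso⟩

end

theorem mainTheorem7 :
    (∃ e : deRhamComplex (Omega 1) ≅ alternatingComplex,
      (∀ k : ℕ, (e.hom.f (2 * k)).hom
        (Omega.wedgePow (Omega.dLinear (Omega 1) 1 (Omega.taut 1)) k) = ULift.up 1) ∧
      (∀ k : ℕ, (e.hom.f (1 + 2 * k)).hom
        (Omega.wedge (Omega.taut 1)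
          (Omega.wedgePow (Omega.dLinear (Omega 1) 1 (Omega.taut 1)) k)) = ULift.up 1)) ∧
    (∀ q : ℕ, Module.finrank ℝ (Omega 1 ⟶ Omega q) = 1) ∧
    (∀ k : ℕ, Submodule.span ℝ
      {Omega.wedgePow (Omega.dLinear (Omega 1) 1 (Omega.taut 1)) k} = ⊤) ∧
    (∀ k : ℕ, Submodule.span ℝ
      {Omega.wedge (Omega.taut 1)
        (Omega.wedgePow (Omega.dLinear (Omega 1) 1 (Omega.taut 1)) k)} = ⊤) ∧
    Nonempty ((deRhamComplex (Omega 1)).homology 0 ≅ ModuleCat.of ℝ (ULift.{1} ℝ)) ∧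
    ∀ q : ℕ, q ≠ 0 → Limits.IsZero ((deRhamComplex (Omega 1)).homology q) := by
  refine ⟨⟨deRhamIso, fun k => ?_, fun k => ?_⟩, fun q => ?_,
    fun k => Omega.span_singleton_eq_top (Omega.evenGen_ne_zero k),
    fun k => Omega.span_singleton_eq_top (Omega.oddGen_ne_zero k), ?_, ?_⟩
  · refine Eq.trans ?_ (deRhamIso_gen (2 * k))
    rw [Omega.gen_even]
  · refine Eq.trans ?_ (deRhamIso_gen (1 + 2 * k))
    rw [Omega.gen_odd]
  · rw [finrank_eq_one_iff']
    exact ⟨Omega.gen q, Omega.gen_ne_zero q, Omega.exists_smul_gen⟩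
  · obtain ⟨i⟩ := alternatingComplex_homology_zero
    exact ⟨(HomologicalComplex.homologyMapIso deRhamIso 0).trans i⟩
  · intro q hq
    obtain ⟨r, rfl⟩ := Nat.exists_eq_succ_of_ne_zero hq
    exact ((alternatingComplex_exactAt r).isZero_homology).of_iso
      (HomologicalComplex.homologyMapIso deRhamIso _)
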